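/- Let $X$ be a second countable locally compact Hausdorff space with its Borel $\sigma$-algebra. Let $\mathscr P(X)$ be the space of Borel probability measures on $X$ with the narrow topology (the weak topology induced by the bounded continuous functions) and the corresponding Borel $\sigma$-algebra, and let $\mathscr P(\mathscr P(X))$ be the space of Borel probability measures on $\mathscr P(X)$, again with the narrow topology. For $\boldsymbol\alpha\in(0,\infty)^k$, $k\ge 1$, let $\mathrm{Dir}_{\boldsymbol\alpha}$ be the Dirichlet distribution on the standard simplex $\{y\in\mathbb R^k: y\ge 0,\ \sum_i y_i=1\}$, i.e. the law of $(z_1,\dots,z_{k-1},z_k)$ with $z_k:=1-\sum_{i<k}z_i$, where $(z_1,\dots,z_{k-1})$ has Lebesgue density $\frac{\Gamma(\sum_i\alpha_i)}{\prod_i\Gamma(\alpha_i)}\prod_{i=1}^k z_i^{\alpha_i-1}$ on $\{z\in\mathbb R^{k-1}: z\ge 0,\ \sum_{i<k} z_i\le 1\}$. Fix $\beta\in(0,\infty)$. For every $\sigma\in\mathscr P(X)$ there is a unique $\mathcal D_{\beta\sigma}\in\mathscr P(\mathscr P(X))$, the Dirichlet--Ferguson measure with intensity $\beta\sigma$, such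 that (i) for every $k\ge1$ and every partition of $X$ into Borel sets $X_1,\dots,X_k$ with $\sigma(X_i)>0$ for all $i$, the law of $(\eta(X_1),\dots,\eta(X_k))$ under $\mathcal D_{\beta\sigma}(d\eta)$ is $\mathrm{Dir}_{(\beta\sigma(X_1),\dots,\beta\sigma(X_k))}$; and (ii) for every Borel set $N\subset X$ with $\sigma(N)=0$, one has $\eta(N)=0$ for $\mathcal D_{\beta\sigma}$-almost every $\eta$. (This is the usual convention for vanishing parameters of the Dirichlet distribution.) The map $\sigma\mapsto\mathcal D_{\beta\sigma}$ from $\mathscr P(X)$ to $\mathscr P(\mathscr P(X))$ is a homeomorphism onto its image for the narrow topologies. Its inverse is the restriction to the image of the barycenter map $G$, where $G(\mu)(A)=\int_{\mathscr P(X)}\eta(A)\,d\mu(\eta)$ for Borel sets $A\subset X$ and $\mu\in\mathscr P(\mathscr P(X))$. -/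

import Mathlib

open MeasureTheory Set Filter Topology

namespace DirichletFerguson

section Narrow

variable {X : Type*} [TopologicalSpace X] [SecondCountableTopology X]
  [MeasurableSpace X] [BorelSpace X]

/-- Every narrowly open set of probability measures belongs to the `σ`-algebra generated by the
evaluations `η ↦ η A`. -/
theorem measurableSet_of_isOpen {U : Set (ProbabilityMeasure X)} (hU : IsOpen U) :
    MeasurableSet U := by
  classical
  let B := TopologicalSpace.countableBasis X
  have hBb : TopologicalSpace.IsTopologicalBasis B := TopologicalSpace.isBasis_countableBasis X
  let S : Set (Set (ProbabilityMeasure X)) :=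
    (fun p : Set (Set X) × ℚ => {η : ProbabilityMeasure X | (p.2 : ℝ) < (η (⋃₀ p.1) : ℝ)}) ''
      ({T : Set (Set X) | T.Finite ∧ T ⊆ B} ×ˢ univ)
  have hSc : S.Countable :=
    (((countable_ofPred_finite_subset (TopologicalSpace.countable_countableBasis X)).prod
      countable_univ).image _)
  have hmeas : ∀ V ∈ S, MeasurableSet V := by
    rintro _ ⟨⟨T, q⟩, ⟨⟨-, hT⟩, -⟩, rfl⟩
    have hTo : MeasurableSet (⋃₀ T) := (isOpen_sUnion fun t ht => hBb.isOpen (hT ht)).measurableSet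
    exact measurableSet_lt measurable_const
      (((Measure.measurable_coe hTo).comp measurable_subtype_coe).ennreal_toReal)
  obtain ⟨t', ht'⟩ : ∃ t' : TopologicalSpace (ProbabilityMeasure X) ,
      t' = TopologicalSpace.generateFrom S := ⟨_, rfl⟩
  have hsc : @SecondCountableTopology _ t' := @SecondCountableTopology.mk _ t' ⟨S, hSc, ht'⟩
  have hborel := @borel_eq_generateFrom_of_subbasis _ S t' hsc ht'
  have hle : t' ≤ ProbabilityMeasure.instTopologicalSpace := by
    refine le_of_nhds_le_nhds fun μ => ?_
    have hcg : (@nhds _ t' μ).IsCountablyGenerated :=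
      @FirstCountableTopology.nhds_generated_countable _ t'
        (@TopologicalSpace.SecondCountableTopology.to_firstCountableTopology _ t' hsc) μ
    refine tendsto_id'.1 (tendsto_of_forall_isOpen_le_liminf' fun G hG => ?_)
    refine le_of_forall_lt fun r hr => ?_
    obtain ⟨s, hrs, hsG⟩ := ENNReal.lt_iff_exists_nnreal_btwn.1 hr
    refine lt_of_lt_of_le hrs (le_liminf_of_le (by isBoundedDefault) ?_)
    have hsG' : s < μ G := by
      rwa [← ProbabilityMeasure.ennreal_coeFn_eq_coeFn_toMeasure, ENNReal.coe_lt_coe] at hsG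
    obtain ⟨T, hTB, hsT, hTG⟩ := μ.exists_lt_measure_biUnion_of_isOpen (S := B)
      (fun u hu x hx => by
        obtain ⟨v, hv, hxv, hvu⟩ := hBb.exists_subset_of_mem_open hx hu
        exact ⟨v, hv, (hBb.isOpen hv).mem_nhds hxv, hvu⟩) hG hsG'
    rw [← Finset.set_biUnion_coe, ← sUnion_eq_biUnion] at hsT hTG
    obtain ⟨q, hsq, hqT⟩ := exists_rat_btwn (NNReal.coe_lt_coe.2 hsT)
    have hV : {η : ProbabilityMeasure X | (q : ℝ) < (η (⋃₀ (T : Set (Set X))) : ℝ)} ∈ S :=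
      ⟨((T : Set (Set X)), q), ⟨⟨T.finite_toSet, fun t ht => hTB t ht⟩, mem_univ _⟩, rfl⟩
    have hVo : IsOpen[t'] {η : ProbabilityMeasure X | (q : ℝ) < (η (⋃₀ (T : Set (Set X))) : ℝ)} :=
      ht' ▸ TopologicalSpace.isOpen_generateFrom_of_mem hV
    filter_upwards [@IsOpen.mem_nhds _ t' μ _ hVo hqT] with η hη
    have h1 : (s : ℝ) < η (⋃₀ (T : Set (Set X))) := hsq.trans hη
    have h2 : s ≤ η G := (NNReal.coe_lt_coe.1 h1).le.trans (ProbabilityMeasure.apply_mono η hTG)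
    rw [id, ← ProbabilityMeasure.ennreal_coeFn_eq_coeFn_toMeasure]
    exact ENNReal.coe_le_coe.2 h2
  have hUb : @MeasurableSet _ (@borel _ t') U :=
    MeasurableSpace.measurableSet_generateFrom (hle U hU)
  rw [hborel] at hUb
  exact MeasurableSpace.generateFrom_le hmeas U hUb

/-- The `σ`-algebra on the space of probability measures is the Borel `σ`-algebra of the narrow
topology. -/
instance instBorelSpaceProbabilityMeasure [TopologicalSpace.PseudoMetrizableSpace X] :
    BorelSpace (ProbabilityMeasure X) := by
  refine ⟨le_antisymm ?_ (MeasurableSpace.generateFrom_le fun U hU => measurableSet_of_isOpen hU)⟩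
  refine Measurable.comap_le ?_
  have hX : (inferInstance : MeasurableSpace X) = .generateFrom {s : Set X | IsOpen s} :=
    BorelSpace.measurable_eq
  have hb : @OpensMeasurableSpace (ProbabilityMeasure X) _ (borel _) :=
    @OpensMeasurableSpace.mk _ _ (borel _) le_rfl
  refine @Measurable.measure_of_isPiSystem_of_isProbabilityMeasure _ _ (borel _) _ _
    (fun η : ProbabilityMeasure X => η.2) _ hX isPiSystem_isOpen fun G hG => ?_
  refine @LowerSemicontinuous.measurable _ _ _ _ _ (borel _) _ _ _ _ hb _ ?_
  refine fun μ => lowerSemicontinuousAt_iff_le_liminf.2 ?_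
  exact ProbabilityMeasure.le_liminf_measure_open_of_tendsto tendsto_id hG

end Narrow
section Dirichlet

/-- The map `z ↦ (z, 1 - ∑ i, z i)`, which identifies the corner simplex with the standard one. -/
noncomputable def complete {m : ℕ} (z : Fin m → ℝ) : Fin (m + 1) → ℝ :=
  Fin.snoc z (1 - ∑ i, z i)

/-- The corner simplex `{z ∈ ℝᵐ | z ≥ 0, ∑ i, z i ≤ 1}`. -/
def cornerSimplex (m : ℕ) : Set (Fin m → ℝ) :=
  {z | (∀ i, 0 ≤ z i) ∧ ∑ i, z i ≤ 1}

/-- The multivariate Beta function `∏ i, Γ(α i) / Γ(∑ i, α i)`. -/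
noncomputable def multiBeta {m : ℕ} (α : Fin (m + 1) → ℝ) : ℝ :=
  (∏ i, Real.Gamma (α i)) / Real.Gamma (∑ i, α i)

/-- The Dirichlet distribution with parameter `α ∈ (0,∞)ᵏ`, `k = m + 1`, as a measure on `ℝᵏ`
carried by the standard simplex: the first `m` coordinates have density
`z ↦ (∏ i, y i ^ (α i - 1)) / B(α)`, `y = (z, 1 - ∑ i, z i)`, on the corner simplex. -/
noncomputable def dirichlet {m : ℕ} (α : Fin (m + 1) → ℝ) : Measure (Fin (m + 1) → ℝ) :=
  ((volume.restrict (cornerSimplex m)).withDensity fun z =>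
    ENNReal.ofReal ((∏ i, complete z i ^ (α i - 1)) / multiBeta α)).map complete

end Dirichlet

section DirichletFerguson

variable {X : Type*} [MeasurableSpace X]

/-- `A` is a measurable partition of `X` into `k` sets of positive `σ`-measure. -/
structure IsNontrivialPartition {k : ℕ} (σ : ProbabilityMeasure X) (A : Fin k → Set X) : Prop where
  measurableSet : ∀ i, MeasurableSet (A i)
  pos : ∀ i, 0 < σ (A i)
  disjoint : ∀ i j, i ≠ j → A i ∩ A j = ∅
  iUnion_eq : ⋃ i, A i = univ

/-- `ev A η = (η (A 1), …, η (A k))`. -/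
def ev {k : ℕ} (A : Fin k → Set X) (η : ProbabilityMeasure X) : Fin k → ℝ :=
  fun i => (η (A i) : ℝ)

/-- `D` is a Dirichlet--Ferguson measure with intensity `βσ`: for every nontrivial measurable
partition `A` of `X` the vector `ev A η` has Dirichlet distribution with parameter `β • ev A σ`
under `D`, and sets that are null for `σ` are null for `D`-almost every `η`. The second condition is
the convention that the component belonging to a vanishing parameter vanishes; it follows from the
first one except when `σ` is a Dirac mass, in which case the first one is void. -/
structure IsDirichletFerguson (β : ℝ) (σ : ProbabilityMeasure X)
    (D : ProbabilityMeasure (ProbabilityMeasure X)) : Prop where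
  map_ev : ∀ (m : ℕ) (A : Fin (m + 1) → Set X), IsNontrivialPartition σ A →
    (D : Measure (ProbabilityMeasure X)).map (ev A) = dirichlet (β • ev A σ)
  null : ∀ N : Set X, MeasurableSet N → σ N = 0 →
    ∀ᵐ η ∂(D : Measure (ProbabilityMeasure X)), η N = 0

open Classical in
/-- The Dirichlet--Ferguson measure with intensity `βσ`, i.e. the unique `D` such that
`IsDirichletFerguson β σ D` (and a Dirac mass if there is none). -/
noncomputable def dirichletFerguson (β : ℝ) (σ : ProbabilityMeasure X) :
    ProbabilityMeasure (ProbabilityMeasure X) :=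
  if h : ∃ D, IsDirichletFerguson β σ D then h.choose
  else ⟨Measure.dirac σ, Measure.dirac.isProbabilityMeasure⟩

theorem measurable_coe : Measurable fun η : ProbabilityMeasure X => (η : Measure X) :=
  measurable_subtype_coe

/-- The barycenter `G(μ) = ∫ η dμ(η)`, i.e. `G(μ) A = ∫ η A dμ(η)`. -/
noncomputable def barycenter (μ : ProbabilityMeasure (ProbabilityMeasure X)) :
    ProbabilityMeasure X :=
  ⟨(μ : Measure (ProbabilityMeasure X)).bind fun η => (η : Measure X), ⟨by
    refine (Measure.bind_apply MeasurableSet.univ measurable_coe.aemeasurable).trans ?_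
    exact (lintegral_congr fun η => measure_univ).trans (by simp)⟩⟩

theorem barycenter_apply (μ : ProbabilityMeasure (ProbabilityMeasure X)) {A : Set X}
    (hA : MeasurableSet A) :
    (barycenter μ : Measure X) A
      = ∫⁻ η, (η : Measure X) A ∂(μ : Measure (ProbabilityMeasure X)) :=
  Measure.bind_apply hA measurable_coe.aemeasurable

end DirichletFerguson

end DirichletFerguson

/-! Everything is read off joint moments. By compactness of the cube, a Dirichlet vector is
determined by its monomial moments, which are quotients of rising factorials. These formulas still
make sense when a parameter vanishes, so the two defining properties of the Dirichlet–Ferguson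
measure become the single condition `HasDirichletMoments` over all measurable maps from `X` to
finite types. This condition determines the law of the random measure
(`HasDirichletMoments.unique`), because the σ-algebra is generated by evaluations.

Existence comes from stick breaking. Take independent proportions `v k` with law Beta(1, β),
independent atoms `x k` with law `σ`, and the random measure `η = ∑ k, stickWeight v k • δ (x k)`.
Separating the first proportion and the first atom gives the distributional equation `η = v • δ x +
(1 - v) • η'`, with `η'` a copy of `η` independent of `(v, x)`. It turns into a linear recursion for
the moments, which the Dirichlet moments satisfy (`dirichletMoment_eq_momentStep`) and which has
only one normalised solution (`eq_dirichletMoment_of_eq_momentStep`).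

This representation also yields continuity in `σ`: the law of the weights does not involve `σ`, the
atoms have law `σ^ℕ`, which depends continuously on `σ`, and for fixed weights of total mass one the
measure `η` depends continuously on the atoms. First moments show that the barycenter of `D_{βσ}` is
`σ`, and the barycenter map is continuous, so it is a continuous left inverse. The topology on `X`
enters through Borel sets and pseudometrizability, the latter holding for second countable locally
compact Hausdorff spaces. -/

namespace DirichletFerguson

/-! ### Normalisation and moments of the Dirichlet distribution. -/

section Dirichlet

theorem complete_cons_zero {m : ℕ} (t : ℝ) (w : Fin m → ℝ) :
    complete (Fin.cons t w : Fin (m + 1) → ℝ) 0 = t := by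
  have : (0 : Fin (m + 2)) = Fin.castSucc 0 := rfl
  rw [complete, this, Fin.snoc_castSucc, Fin.cons_zero]

/-- The slice of the simplex with first coordinate `t` is the simplex of one dimension less, scaled
by `1 - t`. This substitution reduces Dirichlet integrals to Beta integrals. -/
theorem complete_cons_smul_succ {m : ℕ} (t : ℝ) (u : Fin m → ℝ) (i : Fin (m + 1)) :
    complete (Fin.cons t ((1 - t) • u) : Fin (m + 1) → ℝ) i.succ = (1 - t) * complete u i := by
  induction i using Fin.lastCases with
  | last =>
    rw [complete, complete, Fin.succ_last, Fin.snoc_last, Fin.snoc_last, Fin.sum_univ_succ]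
    simp only [Fin.cons_zero, Fin.cons_succ, Pi.smul_apply, smul_eq_mul, ← Finset.mul_sum]
    ring
  | cast i =>
    rw [complete, complete, Fin.succ_castSucc, Fin.snoc_castSucc, Fin.snoc_castSucc]
    simp

theorem cons_smul_mem_cornerSimplex {m : ℕ} {t : ℝ} (h0 : 0 ≤ t) (h1 : t < 1)
    (u : Fin m → ℝ) :
    (Fin.cons t ((1 - t) • u) : Fin (m + 1) → ℝ) ∈ cornerSimplex (m + 1)
      ↔ u ∈ cornerSimplex m := by
  have hs : 0 < 1 - t := by linarith
  simp only [cornerSimplex, mem_ofPred_eq, Fin.forall_fin_succ, Fin.cons_zero, Fin.cons_succ,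
    Fin.sum_univ_succ, Pi.smul_apply, smul_eq_mul, ← Finset.mul_sum, mul_nonneg_iff_of_pos_left hs,
    h0, true_and]
  refine and_congr_right fun _ => ⟨fun h => ?_, fun h => by nlinarith⟩
  by_contra! h'
  nlinarith

theorem measurableSet_cornerSimplex (m : ℕ) : MeasurableSet (cornerSimplex m) := by
  have : cornerSimplex m = (⋂ i, {z : Fin m → ℝ | 0 ≤ z i}) ∩ {z | ∑ i, z i ≤ 1} := by
    ext z; simp [cornerSimplex]
  rw [this]
  exact (MeasurableSet.iInter fun i => measurableSet_le measurable_const (measurable_pi_apply i)).inter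
    (measurableSet_le (by fun_prop) measurable_const)

theorem measurable_complete {m : ℕ} : Measurable (complete : (Fin m → ℝ) → Fin (m + 1) → ℝ) := by
  refine measurable_pi_lambda _ fun i => ?_
  induction i using Fin.lastCases with
  | last => simp only [complete, Fin.snoc_last]; fun_prop
  | cast i => simp only [complete, Fin.snoc_castSucc]; fun_prop

theorem complete_mem_Icc {m : ℕ} {z : Fin m → ℝ} (hz : z ∈ cornerSimplex m) (i : Fin (m + 1)) :
    complete z i ∈ Icc (0 : ℝ) 1 := by
  have hs : 0 ≤ ∑ i, z i := Finset.sum_nonneg fun i _ => hz.1 i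
  induction i using Fin.lastCases with
  | last => simp only [complete, Fin.snoc_last]; exact ⟨by linarith [hz.2], by linarith⟩
  | cast i =>
    simp only [complete, Fin.snoc_castSucc]
    exact ⟨hz.1 i, (Finset.single_le_sum (fun j _ => hz.1 j) (Finset.mem_univ i)).trans hz.2⟩

theorem lintegral_comp_smul_pi {m : ℕ} {s : ℝ} (hs : 0 < s) {g : (Fin m → ℝ) → ENNReal}
    (hg : Measurable g) : ∫⁻ w, g w = ENNReal.ofReal (s ^ m) * ∫⁻ u, g (s • u) := by
  have h := lintegral_map (μ := (volume : Measure (Fin m → ℝ))) hg (measurable_const_smul s)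
  rw [Measure.map_addHaar_smul _ hs.ne', lintegral_smul_measure] at h
  rw [← h, smul_eq_mul, ← mul_assoc, Module.finrank_fin_fun, abs_of_pos (by positivity),
    ← ENNReal.ofReal_mul (by positivity), mul_inv_cancel₀ (by positivity), ENNReal.ofReal_one,
    one_mul]

theorem lintegral_cons {m : ℕ} {g : (Fin (m + 1) → ℝ) → ENNReal} (hg : Measurable g) :
    ∫⁻ z, g z = ∫⁻ t : ℝ, ∫⁻ w : Fin m → ℝ, g (Fin.cons t w) := by
  have h := (volume_preserving_piFinSuccAbove (fun _ : Fin (m + 1) => ℝ) 0).symm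
  rw [← h.lintegral_comp hg, Measure.volume_eq_prod, lintegral_prod]
  · refine lintegral_congr fun t => lintegral_congr fun w => congrArg g ?_
    exact Fin.insertNth_zero' t w
  · exact (hg.comp h.measurable).aemeasurable

/-- The unnormalised Dirichlet density on the corner simplex. -/
noncomputable def simplexDensity {m : ℕ} (α : Fin (m + 1) → ℝ) : (Fin m → ℝ) → ENNReal :=
  (cornerSimplex m).indicator fun z => ENNReal.ofReal (∏ i, complete z i ^ (α i - 1))

theorem measurable_prod_complete_rpow {m : ℕ} (α : Fin (m + 1) → ℝ) :
    Measurable fun z : Fin m → ℝ => ∏ i, complete z i ^ (α i - 1) :=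
  Finset.measurable_prod _ fun i _ =>
    ((measurable_pi_apply i).comp measurable_complete).pow_const _

theorem measurable_simplexDensity {m : ℕ} (α : Fin (m + 1) → ℝ) :
    Measurable (simplexDensity α) :=
  (measurable_prod_complete_rpow α).ennreal_ofReal.indicator (measurableSet_cornerSimplex m)

theorem simplexDensity_cons_smul {m : ℕ} (α : Fin (m + 2) → ℝ) {t : ℝ} (h0 : 0 < t) (h1 : t < 1)
    (u : Fin m → ℝ) :
    simplexDensity α (Fin.cons t ((1 - t) • u)) =
      ENNReal.ofReal (t ^ (α 0 - 1) * (1 - t) ^ (∑ i : Fin (m + 1), (α i.succ - 1)))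
        * simplexDensity (fun i => α i.succ) u := by
  have hs : 0 < 1 - t := by linarith
  by_cases hu : u ∈ cornerSimplex m
  · rw [simplexDensity, simplexDensity, indicator_of_mem hu,
      indicator_of_mem ((cons_smul_mem_cornerSimplex h0.le h1 u).2 hu),
      ← ENNReal.ofReal_mul (by positivity), Fin.prod_univ_succ, complete_cons_zero]
    simp only [complete_cons_smul_succ]
    rw [Finset.prod_congr rfl fun i _ => Real.mul_rpow hs.le (complete_mem_Icc hu i).1,
      Finset.prod_mul_distrib, ← Real.rpow_sum_of_pos hs, mul_assoc]
  · rw [simplexDensity, simplexDensity, indicator_of_notMem hu,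
      indicator_of_notMem (mt (cons_smul_mem_cornerSimplex h0.le h1 u).1 hu), mul_zero]

theorem multiBeta_pos {m : ℕ} {α : Fin (m + 1) → ℝ} (hα : ∀ i, 0 < α i) : 0 < multiBeta α :=
  div_pos (Finset.prod_pos fun i _ => Real.Gamma_pos_of_pos (hα i))
    (Real.Gamma_pos_of_pos (Finset.sum_pos (fun i _ => hα i) Finset.univ_nonempty))

theorem multiBeta_succ {m : ℕ} {α : Fin (m + 2) → ℝ} (hα : ∀ i, 0 < α i) :
    multiBeta α = ProbabilityTheory.beta (α 0) (∑ i : Fin (m + 1), α i.succ)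
      * multiBeta fun i => α i.succ := by
  have h : Real.Gamma (∑ i : Fin (m + 1), α i.succ) ≠ 0 :=
    (Real.Gamma_pos_of_pos (Finset.sum_pos (fun i _ => hα i.succ) Finset.univ_nonempty)).ne'
  rw [multiBeta, multiBeta, ProbabilityTheory.beta, Fin.prod_univ_succ, Fin.sum_univ_succ]
  field_simp

theorem lintegral_beta {a b : ℝ} (ha : 0 < a) (hb : 0 < b) :
    ∫⁻ t in Ioo (0 : ℝ) 1, ENNReal.ofReal (t ^ (a - 1) * (1 - t) ^ (b - 1))
      = ENNReal.ofReal (ProbabilityTheory.beta a b) := by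
  have hB := ProbabilityTheory.beta_pos ha hb
  have h := ProbabilityTheory.lintegral_betaPDF_eq_one ha hb
  rw [ProbabilityTheory.lintegral_betaPDF] at h
  simp_rw [mul_assoc, ENNReal.ofReal_mul (one_div_pos.2 hB).le] at h
  rw [lintegral_const_mul _ (by fun_prop)] at h
  calc _ = ENNReal.ofReal (ProbabilityTheory.beta a b) * (ENNReal.ofReal
        (1 / ProbabilityTheory.beta a b) * ∫⁻ t in Ioo (0 : ℝ) 1,
          ENNReal.ofReal (t ^ (a - 1) * (1 - t) ^ (b - 1))) := by
        rw [← mul_assoc, ← ENNReal.ofReal_mul hB.le, mul_one_div_cancel hB.ne']; simp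
    _ = _ := by rw [h, mul_one]

theorem lintegral_simplexDensity {m : ℕ} {α : Fin (m + 1) → ℝ} (hα : ∀ i, 0 < α i) :
    ∫⁻ z, simplexDensity α z = ENNReal.ofReal (multiBeta α) := by
  induction m with
  | zero =>
    -- In dimension zero the only completed coordinate is `1`, so the density is `1` whatever the
    -- exponent.
    have h0 : ∀ z : Fin 0 → ℝ, simplexDensity α z = 1 := fun z => by
      rw [simplexDensity, indicator_of_mem (by simp [cornerSimplex])]
      simp [complete, Fin.snoc]
    simp only [h0, lintegral_one]
    simp [multiBeta, (Real.Gamma_pos_of_pos (hα 0)).ne', volume_pi]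
  | succ m ih =>
    have hz : ∀ t : ℝ, t ∉ Icc (0 : ℝ) 1 → ∀ w : Fin m → ℝ,
        simplexDensity α (Fin.cons t w) = 0 := by
      refine fun t ht w => indicator_of_notMem (fun h => ht ⟨by simpa using h.1 0, ?_⟩) _
      have h1 := Finset.single_le_sum (f := (Fin.cons t w : Fin (m + 1) → ℝ))
        (fun i _ => h.1 i) (Finset.mem_univ 0)
      exact (by simpa using h1 : t ≤ _).trans h.2
    have hb : 0 < ∑ i : Fin (m + 1), α i.succ :=
      Finset.sum_pos (fun i _ => hα i.succ) Finset.univ_nonempty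
    calc ∫⁻ z, simplexDensity α z
        = ∫⁻ t : ℝ, ∫⁻ w : Fin m → ℝ, simplexDensity α (Fin.cons t w) :=
          lintegral_cons (measurable_simplexDensity α)
      _ = ∫⁻ t in Icc (0 : ℝ) 1, ∫⁻ w : Fin m → ℝ, simplexDensity α (Fin.cons t w) := by
          refine (setLIntegral_eq_of_support_subset fun t ht => ?_).symm
          by_contra h
          exact ht (by simp [hz t h])
      -- The endpoints are removed because the rescaling of the slice needs `1 - t ≠ 0`.
      _ = ∫⁻ t in Ioo (0 : ℝ) 1, ∫⁻ w : Fin m → ℝ, simplexDensity α (Fin.cons t w) := by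
          rw [restrict_Ioo_eq_restrict_Icc]
      _ = ∫⁻ t in Ioo (0 : ℝ) 1, ENNReal.ofReal (t ^ (α 0 - 1)
            * (1 - t) ^ ((∑ i : Fin (m + 1), α i.succ) - 1))
            * ENNReal.ofReal (multiBeta fun i => α i.succ) := by
          refine setLIntegral_congr_fun measurableSet_Ioo fun t ht => ?_
          have hs : 0 < 1 - t := by linarith [ht.2]
          have hm : Measurable fun w : Fin m → ℝ => simplexDensity α (Fin.cons t w) := by
            refine (measurable_simplexDensity α).comp (measurable_pi_lambda _ fun i => ?_)
            induction i using Fin.cases with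
            | zero => simp
            | succ i => simpa using measurable_pi_apply i
          rw [lintegral_comp_smul_pi hs hm]
          simp only [simplexDensity_cons_smul α ht.1 ht.2]
          rw [lintegral_const_mul _ (measurable_simplexDensity _), ih fun i => hα i.succ,
            ← mul_assoc, ← ENNReal.ofReal_mul (by positivity)]
          congr 2
          -- The Jacobian `(1 - t) ^ m` compensates for all but one of the `m + 1` summands `-1` in
          -- the exponent, leaving that of a Beta density.
          rw [mul_left_comm, ← Real.rpow_natCast, ← Real.rpow_add hs]
          congr 2
          simp only [Finset.sum_sub_distrib, Finset.sum_const, Finset.card_univ, Fintype.card_fin,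
            nsmul_eq_mul, Nat.cast_add, Nat.cast_one]
          ring
      _ = _ := by
          rw [lintegral_mul_const _ (by fun_prop), lintegral_beta (hα 0) hb, multiBeta_succ hα,
            ENNReal.ofReal_mul (ProbabilityTheory.beta_pos (hα 0) hb).le]

theorem lintegral_dirichlet {m : ℕ} (α : Fin (m + 1) → ℝ) {f : (Fin (m + 1) → ℝ) → ENNReal}
    (hf : Measurable f) :
    ∫⁻ y, f y ∂dirichlet α = ∫⁻ z in cornerSimplex m,
      ENNReal.ofReal ((∏ i, complete z i ^ (α i - 1)) / multiBeta α) * f (complete z) := by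
  rw [dirichlet, lintegral_map hf measurable_complete, lintegral_withDensity_eq_lintegral_mul _
    ((measurable_prod_complete_rpow α).div_const _).ennreal_ofReal
    (g := fun z => f (complete z)) (hf.comp measurable_complete)]
  rfl

theorem dirichlet_ae_mem_Icc {m : ℕ} (α : Fin (m + 1) → ℝ) :
    ∀ᵐ y ∂dirichlet α, ∀ i, y i ∈ Icc (0 : ℝ) 1 := by
  have hS : MeasurableSet {y : Fin (m + 1) → ℝ | ∀ i, y i ∈ Icc (0 : ℝ) 1} := by
    rw [ofPred_forall]
    exact MeasurableSet.iInter fun i => measurable_pi_apply i measurableSet_Icc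
  rw [dirichlet, ae_map_iff measurable_complete.aemeasurable hS]
  refine (withDensity_absolutelyContinuous _ _).ae_le ?_
  exact ae_restrict_of_forall_mem (measurableSet_cornerSimplex m) fun z hz => complete_mem_Icc hz

/-- At `y = 0` with `n ≥ 1`, the condition `0 < a` makes the exponent on the right nonzero, so the
convention `0 ^ 0 = 1` does not interfere. -/
theorem rpow_sub_one_mul_pow {a y : ℝ} (ha : 0 < a) (hy : 0 ≤ y) (n : ℕ) :
    y ^ (a - 1) * y ^ n = y ^ (a + n - 1) := by
  rcases hy.eq_or_lt with rfl | hy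
  · rcases n.eq_zero_or_pos with rfl | hn
    · simp
    · have : (1 : ℝ) ≤ n := by exact_mod_cast hn
      rw [zero_pow hn.ne', mul_zero, Real.zero_rpow (by linarith)]
  · rw [← Real.rpow_natCast, ← Real.rpow_add hy]
    ring_nf

/-- Multiplying the Dirichlet density by a monomial only shifts the parameters, so the moment is a
quotient of two normalising constants. -/
theorem lintegral_dirichlet_monomial {m : ℕ} {α : Fin (m + 1) → ℝ} (hα : ∀ i, 0 < α i)
    (n : Fin (m + 1) → ℕ) :
    ∫⁻ y, ENNReal.ofReal (∏ i, y i ^ n i) ∂dirichlet α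
      = ENNReal.ofReal (multiBeta (fun i => α i + n i) / multiBeta α) := by
  have hB := multiBeta_pos hα
  have hα' : ∀ i, 0 < α i + n i := fun i => add_pos_of_pos_of_nonneg (hα i) (Nat.cast_nonneg _)
  rw [lintegral_dirichlet α (by fun_prop), div_eq_inv_mul, ENNReal.ofReal_mul (inv_pos.2 hB).le,
    ← lintegral_simplexDensity hα', ← lintegral_const_mul _ (measurable_simplexDensity _),
    ← lintegral_indicator (measurableSet_cornerSimplex m)]
  refine lintegral_congr fun z => ?_
  by_cases hz : z ∈ cornerSimplex m
  · have h0 : ∀ i, 0 ≤ complete z i := fun i => (complete_mem_Icc hz i).1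
    have h1 : 0 ≤ ∏ i, complete z i ^ (α i - 1) :=
      Finset.prod_nonneg fun i _ => Real.rpow_nonneg (h0 i) _
    rw [simplexDensity, indicator_of_mem hz, indicator_of_mem hz,
      ← ENNReal.ofReal_mul (by positivity), ← ENNReal.ofReal_mul (by positivity), div_eq_inv_mul,
      mul_assoc, ← Finset.prod_mul_distrib,
      Finset.prod_congr rfl fun i _ => rpow_sub_one_mul_pow (hα i) (h0 i) (n i)]
  · simp [simplexDensity, hz]

theorem isProbabilityMeasure_dirichlet {m : ℕ} {α : Fin (m + 1) → ℝ} (hα : ∀ i, 0 < α i) :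
    IsProbabilityMeasure (dirichlet α) := by
  refine ⟨?_⟩
  have h := lintegral_dirichlet_monomial hα 0
  simpa [(multiBeta_pos hα).ne'] using h

/-- The ascending factorial `a (a + 1) ⋯ (a + n - 1)`. -/
noncomputable def risingFactorial (a : ℝ) (n : ℕ) : ℝ := ∏ k ∈ Finset.range n, (a + k)

theorem risingFactorial_zero (a : ℝ) : risingFactorial a 0 = 1 := by simp [risingFactorial]

theorem risingFactorial_succ (a : ℝ) (n : ℕ) :
    risingFactorial a (n + 1) = risingFactorial a n * (a + n) := Finset.prod_range_succ _ _

theorem risingFactorial_pos {a : ℝ} (ha : 0 < a) (n : ℕ) : 0 < risingFactorial a n :=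
  Finset.prod_pos fun _ _ => by positivity

theorem risingFactorial_zero_left {n : ℕ} (hn : n ≠ 0) : risingFactorial 0 n = 0 :=
  Finset.prod_eq_zero (Finset.mem_range.2 (Nat.pos_of_ne_zero hn)) (by simp)

theorem Gamma_add_natCast {a : ℝ} (ha : 0 < a) (n : ℕ) :
    Real.Gamma (a + n) = risingFactorial a n * Real.Gamma a := by
  induction n with
  | zero => simp [risingFactorial_zero]
  | succ n ih =>
    rw [Nat.cast_succ, ← add_assoc, Real.Gamma_add_one (by positivity), ih, risingFactorial_succ]
    ring

/-- Rising factorials replace the Gamma quotients because they remain meaningful when some `α i` is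
zero. -/
theorem integral_dirichlet_monomial {m : ℕ} {α : Fin (m + 1) → ℝ} (hα : ∀ i, 0 < α i)
    (n : Fin (m + 1) → ℕ) :
    ∫ y, ∏ i, y i ^ n i ∂dirichlet α
      = (∏ i, risingFactorial (α i) (n i)) / risingFactorial (∑ i, α i) (∑ i, n i) := by
  have hα' : ∀ i, 0 < α i + n i := fun i => add_pos_of_pos_of_nonneg (hα i) (Nat.cast_nonneg _)
  have hs : 0 < ∑ i, α i := Finset.sum_pos (fun i _ => hα i) Finset.univ_nonempty
  rw [integral_eq_lintegral_of_nonneg_ae, lintegral_dirichlet_monomial hα, ENNReal.toReal_ofReal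
    (div_pos (multiBeta_pos hα') (multiBeta_pos hα)).le]
  · have h1 : ∏ i, Real.Gamma (α i) ≠ 0 :=
      (Finset.prod_pos fun i _ => Real.Gamma_pos_of_pos (hα i)).ne'
    have h2 := (Real.Gamma_pos_of_pos hs).ne'
    have h3 := (risingFactorial_pos hs (∑ i, n i)).ne'
    rw [multiBeta, multiBeta, Finset.prod_congr rfl fun i _ => Gamma_add_natCast (hα i) (n i),
      Finset.prod_mul_distrib, Finset.sum_add_distrib, ← Nat.cast_sum, Gamma_add_natCast hs]
    field_simp
  · filter_upwards [dirichlet_ae_mem_Icc α] with y hy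
    exact Finset.prod_nonneg fun i _ => pow_nonneg (hy i).1 _
  · exact Measurable.aestronglyMeasurable (by fun_prop)

end Dirichlet

/-! ### The moment problem on the unit cube. -/

section Moments

/-- Finite measures on the unit cube with the same monomial moments are equal. -/
theorem Measure.ext_of_integral_monomial {ι : Type*} [Fintype ι] {μ ν : Measure (ι → ℝ)}
    [IsFiniteMeasure μ] [IsFiniteMeasure ν] (hμ : ∀ᵐ y ∂μ, ∀ i, y i ∈ Icc (0 : ℝ) 1)
    (hν : ∀ᵐ y ∂ν, ∀ i, y i ∈ Icc (0 : ℝ) 1)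
    (h : ∀ n : ι → ℕ, ∫ y, ∏ i, y i ^ n i ∂μ = ∫ y, ∏ i, y i ^ n i ∂ν) : μ = ν := by
  classical
  let K : Set (ι → ℝ) := univ.pi fun _ => Icc (0 : ℝ) 1
  have hK : IsCompact K := isCompact_univ_pi fun _ => isCompact_Icc
  have : CompactSpace K := isCompact_iff_compactSpace.1 hK
  have hμK : ∀ᵐ y ∂μ, y ∈ K := hμ.mono fun y hy i _ => hy i
  have hνK : ∀ᵐ y ∂ν, y ∈ K := hν.mono fun y hy i _ => hy i
  have hint : ∀ (ρ : Measure (ι → ℝ)) [IsFiniteMeasure ρ], (∀ᵐ y ∂ρ, y ∈ K) →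
      ∀ f : (ι → ℝ) → ℝ, Continuous f → Integrable f ρ := by
    intro ρ _ hρ f hf
    obtain ⟨C, hC⟩ := hK.exists_bound_of_continuousOn hf.continuousOn
    exact Integrable.of_bound hf.aestronglyMeasurable C (hρ.mono hC)
  have hpoly : ∀ p : MvPolynomial ι ℝ, ∫ y, p.eval y ∂μ = ∫ y, p.eval y ∂ν := by
    intro p
    simp only [MvPolynomial.eval_eq']
    rw [integral_finsetSum, integral_finsetSum]
    · simp only [integral_const_mul, h]
    · exact fun d _ => hint ν hνK _ (by fun_prop)
    · exact fun d _ => hint μ hμK _ (by fun_prop)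
  let coord : ι → C(K, ℝ) := fun i =>
    ⟨fun y => y.1 i, (continuous_apply i).comp continuous_subtype_val⟩
  let A : Subalgebra ℝ C(K, ℝ) := (MvPolynomial.aeval (R := ℝ) coord).range
  have hA : A.SeparatesPoints := by
    intro x y hxy
    obtain ⟨i, hi⟩ : ∃ i, x.1 i ≠ y.1 i := by
      by_contra! hh
      exact hxy (Subtype.ext (funext hh))
    exact ⟨_, ⟨_, ⟨MvPolynomial.X i, rfl⟩, rfl⟩, by simpa [coord] using hi⟩
  have happ : ∀ (p : MvPolynomial ι ℝ) (y : K),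
      MvPolynomial.aeval (R := ℝ) coord p y = p.eval y.1 := by
    intro p y
    induction p using MvPolynomial.induction_on with
    | C a => simp
    | add p q hp hq => simp [hp, hq]
    | mul_X p i hp => simp [hp, coord]
  refine ext_of_forall_integral_eq_of_IsFiniteMeasure fun f => ?_
  refine eq_of_forall_dist_le fun ε hε => ?_
  -- The summand `1` keeps `c` positive even if both measures vanish.
  let c : ℝ := μ.real univ + ν.real univ + 1
  have hc : 0 < c := by positivity
  -- Stone–Weierstrass on the cube: a polynomial within `ε / c` of `f`.
  obtain ⟨⟨_, ⟨p, rfl⟩⟩, hg⟩ := ContinuousMap.exists_mem_subalgebra_near_continuous_of_separatesPoints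
    A hA (fun y : K => f y.1) (by fun_prop) (ε / c) (by positivity)
  have hbd : ∀ (ρ : Measure (ι → ℝ)) [IsFiniteMeasure ρ], (∀ᵐ y ∂ρ, y ∈ K) →
      ‖∫ y, p.eval y ∂ρ - ∫ y, f y ∂ρ‖ ≤ ε / c * ρ.real univ := by
    intro ρ _ hρ
    rw [← integral_sub (hint ρ hρ _ (MvPolynomial.continuous_eval p)) (hint ρ hρ _ f.continuous)]
    refine norm_integral_le_of_norm_le_const (hρ.mono fun y hy => ?_)
    have := (hg ⟨y, hy⟩).le
    rw [← happ p ⟨y, hy⟩]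
    exact this
  have h1 := hbd μ hμK
  have h2 := hbd ν hνK
  rw [hpoly, ← dist_eq_norm] at h1
  rw [← dist_eq_norm] at h2
  calc dist (∫ y, f y ∂μ) (∫ y, f y ∂ν)
      ≤ ε / c * μ.real univ + ε / c * ν.real univ :=
        (dist_triangle_left _ _ _).trans (add_le_add h1 h2)
    _ = ε / c * (μ.real univ + ν.real univ) := by ring
    _ ≤ ε / c * c := by gcongr; simp [c]
    _ = ε := by field_simp

end Moments

/-! ### Equivalence of the defining properties with the moment formulas, and uniqueness. -/

section MomentCharacterisation

variable {X : Type*} [MeasurableSpace X]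

/-- The moments of the evaluations of a random measure on the fibres of a map to a finite type are
those of a Dirichlet distribution, where parameters are allowed to vanish. -/
def HasDirichletMoments (β : ℝ) (σ : ProbabilityMeasure X)
    (D : Measure (ProbabilityMeasure X)) : Prop :=
  ∀ (κ : Type) [Fintype κ] (g : X → κ), (∀ i, MeasurableSet (g ⁻¹' {i})) → ∀ n : κ → ℕ,
    ∫ η : ProbabilityMeasure X, ∏ i, (η : Measure X).real (g ⁻¹' {i}) ^ n i ∂D
      = (∏ i, risingFactorial (β * (σ : Measure X).real (g ⁻¹' {i})) (n i))
        / risingFactorial β (∑ i, n i)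

theorem measurable_real_apply {A : Set X} (hA : MeasurableSet A) :
    Measurable fun η : ProbabilityMeasure X => (η : Measure X).real A :=
  ((Measure.measurable_coe hA).comp measurable_subtype_coe).ennreal_toReal

theorem measurable_ev {k : ℕ} {A : Fin k → Set X} (hA : ∀ i, MeasurableSet (A i)) :
    Measurable (ev A) :=
  measurable_pi_lambda _ fun i => measurable_real_apply (hA i)

theorem measureReal_preimage_eq_sum {κ : Type*} [Fintype κ] {g : X → κ}
    (hg : ∀ i, MeasurableSet (g ⁻¹' {i})) (ρ : Measure X) [IsFiniteMeasure ρ] (s : Finset κ) :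
    ρ.real (g ⁻¹' s) = ∑ i ∈ s, ρ.real (g ⁻¹' {i}) := by
  have : g ⁻¹' (s : Set κ) = ⋃ i ∈ s, g ⁻¹' {i} := by ext x; simp
  rw [this, measureReal_biUnion_finset (fun i _ j _ hij => ?_) fun i _ => hg i]
  exact Disjoint.preimage g (by simpa using hij)

theorem sum_measureReal_fiber {κ : Type*} [Fintype κ] {g : X → κ}
    (hg : ∀ i, MeasurableSet (g ⁻¹' {i})) (ρ : Measure X) [IsProbabilityMeasure ρ] :
    ∑ i, ρ.real (g ⁻¹' {i}) = 1 := by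
  rw [← measureReal_preimage_eq_sum hg]
  simp

/-- This matches the moments of a component that vanishes almost surely, including the case `0 ^ 0 =
1`. -/
theorem risingFactorial_zero_left_eq_pow (n : ℕ) : risingFactorial 0 n = 0 ^ n := by
  rcases n.eq_zero_or_pos with rfl | hn
  · simp [risingFactorial_zero]
  · rw [risingFactorial_zero_left hn.ne', zero_pow hn.ne']

/-- Merging the `σ`-null fibres into a non-null one gives a nontrivial partition with known
Dirichlet law. By the null-set property this changes the masses of the non-null fibres only on a
null event, and the null fibres contribute factors `0 ^ n i`. -/
theorem IsDirichletFerguson.hasDirichletMoments {β : ℝ} (hβ : 0 < β) {σ : ProbabilityMeasure X}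
    {D : ProbabilityMeasure (ProbabilityMeasure X)} (h : IsDirichletFerguson β σ D) :
    HasDirichletMoments β σ D := by
  classical
  intro κ _ g hg n
  let P : κ → Prop := fun i => 0 < (σ : Measure X).real (g ⁻¹' {i})
  obtain ⟨i₀, hi₀⟩ : ∃ i, P i := by
    by_contra! hh
    have h1 := sum_measureReal_fiber hg (σ : Measure X)
    rw [Finset.sum_eq_zero fun i _ => le_antisymm (not_lt.1 (hh i)) measureReal_nonneg] at h1
    exact zero_ne_one h1
  have hP : ∀ i, ¬ P i → (σ : Measure X).real (g ⁻¹' {i}) = 0 := fun i hi =>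
    le_antisymm (not_lt.1 hi) measureReal_nonneg
  have : Nonempty {i // P i} := ⟨⟨i₀, hi₀⟩⟩
  obtain ⟨m, ⟨e⟩⟩ : ∃ m, Nonempty (Fin (m + 1) ≃ {i // P i}) := by
    have hc : Fintype.card {i // P i} ≠ 0 := Fintype.card_ne_zero
    obtain ⟨m, hm⟩ := Nat.exists_eq_succ_of_ne_zero hc
    exact ⟨m, ⟨(Fintype.equivFinOfCardEq hm).symm⟩⟩
  -- All null fibres are sent to the index `i₀` of a fibre of positive mass.
  let g' : X → {i // P i} := fun x => if hx : P (g x) then ⟨g x, hx⟩ else ⟨i₀, hi₀⟩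
  let A : Fin (m + 1) → Set X := fun j => g' ⁻¹' {e j}
  have hfin : ∀ s : Set κ, MeasurableSet (g ⁻¹' s) := fun s => by
    rw [← biUnion_preimage_singleton]
    exact MeasurableSet.biUnion s.toFinite.countable fun i _ => hg i
  have hA : ∀ j, MeasurableSet (A j) := fun j => by
    have : A j = g ⁻¹' {i | (if hx : P i then (⟨i, hx⟩ : {i // P i}) else ⟨i₀, hi₀⟩) = e j} := rfl
    rw [this]
    exact hfin _
  have hcongr : ∀ ρ : ProbabilityMeasure X, (∀ i, ¬ P i → (ρ : Measure X).real (g ⁻¹' {i}) = 0) →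
      ∀ j, (ρ : Measure X).real (A j) = (ρ : Measure X).real (g ⁻¹' {(e j).1}) := by
    intro ρ hρ j
    refine measureReal_congr ?_
    have hae : ∀ᵐ x ∂(ρ : Measure X), P (g x) := by
      have : ∀ᵐ x ∂(ρ : Measure X), ∀ i, ¬ P i → g x ≠ i := by
        refine ae_all_iff.2 fun i => ?_
        by_cases hi : P i
        · simp [hi]
        · simp only [hi, not_false_eq_true, forall_true_left]
          have := (measureReal_eq_zero_iff).1 (hρ i hi)
          filter_upwards [measure_eq_zero_iff_ae_notMem.1 this] with x hx using hx
      filter_upwards [this] with x hx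
      by_contra hh
      exact hx _ hh rfl
    filter_upwards [hae] with x hx
    have : (g' x = e j) = (g x = (e j).1) := by
      simp only [g', dif_pos hx, Subtype.ext_iff]
    exact this
  have hσ := hcongr σ hP
  have hpart : IsNontrivialPartition σ A := by
    refine ⟨hA, fun j => ?_, fun i j hij => ?_, ?_⟩
    · have h1 : 0 < (σ : Measure X).real (A j) := by rw [hσ j]; exact (e j).2
      exact h1
    · rw [← disjoint_iff_inter_eq_empty]
      exact Disjoint.preimage g' (by simpa using hij)
    · refine eq_univ_of_forall fun x => mem_iUnion.2 ⟨e.symm (g' x), ?_⟩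
      simp [A]
  have hnull : ∀ᵐ η : ProbabilityMeasure X ∂(D : Measure (ProbabilityMeasure X)),
      ∀ i, ¬ P i → (η : Measure X).real (g ⁻¹' {i}) = 0 := by
    refine ae_all_iff.2 fun i => ?_
    by_cases hi : P i
    · simp [hi]
    · have h0 : σ (g ⁻¹' {i}) = 0 := NNReal.coe_eq_zero.1 (hP i hi)
      filter_upwards [h.null _ (hg i) h0] with η hη _
      exact NNReal.coe_eq_zero.2 hη
  have hsplit : ∀ f : κ → ℝ, ∏ i, f i = (∏ j, f (e j).1) * ∏ i : {i // ¬ P i}, f i.1 := by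
    intro f
    rw [← Fintype.prod_subtype_mul_prod_subtype P f]
    congr 1
    exact (Fintype.prod_equiv e _ _ fun _ => rfl).symm
  have hpos : ∀ j, 0 < (β • ev A σ) j := fun j => by
    have h1 : 0 < (σ : Measure X).real (A j) := by rw [hσ j]; exact (e j).2
    exact mul_pos hβ h1
  have hAsum : ∑ j, (β • ev A σ) j = β := by
    have h1 : ∑ j, (σ : Measure X).real (A j) = 1 := by
      have h2 := sum_measureReal_fiber (g := fun x => e.symm (g' x)) (fun j => by
        convert hA j using 1; ext x; simp [A, Equiv.symm_apply_eq]) (σ : Measure X)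
      rw [← h2]
      refine Finset.sum_congr rfl fun j _ => ?_
      congr 1; ext x; simp [A, Equiv.symm_apply_eq]
    calc ∑ j, (β • ev A σ) j = β * ∑ j, (σ : Measure X).real (A j) := by
          rw [Finset.mul_sum]; rfl
      _ = β := by rw [h1, mul_one]
  have key : ∫ η : ProbabilityMeasure X, ∏ j, (η : Measure X).real (A j) ^ n (e j).1 ∂
      (D : Measure (ProbabilityMeasure X))
      = (∏ j, risingFactorial (β * (σ : Measure X).real (A j)) (n (e j).1))
        / risingFactorial β (∑ j, n (e j).1) := by
    have h1 := integral_dirichlet_monomial hpos fun j => n (e j).1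
    rw [← h.map_ev m A hpart, integral_map (measurable_ev hA).aemeasurable
      (Measurable.aestronglyMeasurable (by fun_prop)), hAsum] at h1
    exact h1
  calc ∫ η : ProbabilityMeasure X, ∏ i, (η : Measure X).real (g ⁻¹' {i}) ^ n i ∂
        (D : Measure (ProbabilityMeasure X))
      = ∫ η : ProbabilityMeasure X, (∏ j, (η : Measure X).real (A j) ^ n (e j).1)
          * ∏ i : {i // ¬ P i}, (0 : ℝ) ^ n i.1 ∂(D : Measure (ProbabilityMeasure X)) := by
        refine integral_congr_ae ?_
        filter_upwards [hnull] with η hη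
        rw [hsplit]
        congr 1
        · exact Finset.prod_congr rfl fun j _ => by rw [hcongr η hη]
        · exact Finset.prod_congr rfl fun i _ => by rw [hη _ i.2]
    _ = ((∏ j, risingFactorial (β * (σ : Measure X).real (A j)) (n (e j).1))
        / risingFactorial β (∑ j, n (e j).1)) * ∏ i : {i // ¬ P i}, (0 : ℝ) ^ n i.1 := by
        rw [integral_mul_const, key]
    _ = _ := by
        rw [hsplit fun i => risingFactorial (β * (σ : Measure X).real (g ⁻¹' {i})) (n i)]
        have h0 : ∏ i : {i // ¬ P i}, risingFactorial
            (β * (σ : Measure X).real (g ⁻¹' {i.1})) (n i.1)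
            = ∏ i : {i // ¬ P i}, (0 : ℝ) ^ n i.1 :=
          Finset.prod_congr rfl fun i _ => by
            rw [hP _ i.2, mul_zero, risingFactorial_zero_left_eq_pow]
        rw [h0]
        simp only [hσ]
        -- Either the null fibres carry no exponent, and the two total degrees agree, or both sides
        -- contain a zero factor.
        by_cases hn : ∀ i : {i // ¬ P i}, n i.1 = 0
        · have hs : ∑ j, n (e j).1 = ∑ i, n i := by
            rw [← Fintype.sum_subtype_add_sum_subtype P n, Finset.sum_eq_zero fun i _ => hn i,
              add_zero]
            exact Fintype.sum_equiv e _ _ fun _ => rfl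
          rw [hs]
          ring
        · push Not at hn
          obtain ⟨i, hi⟩ := hn
          rw [Finset.prod_eq_zero (Finset.mem_univ i) (zero_pow hi)]
          simp

theorem measureReal_fiber_mem_Icc (η : ProbabilityMeasure X) (A : Set X) :
    (η : Measure X).real A ∈ Icc (0 : ℝ) 1 := ⟨measureReal_nonneg, measureReal_le_one⟩

theorem HasDirichletMoments.isDirichletFerguson {β : ℝ} (hβ : 0 < β) {σ : ProbabilityMeasure X}
    {D : ProbabilityMeasure (ProbabilityMeasure X)} (h : HasDirichletMoments β σ D) :
    IsDirichletFerguson β σ D := by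
  classical
  refine ⟨fun m A hA => ?_, fun N hN hσN => ?_⟩
  · have hex : ∀ x, ∃ i, x ∈ A i := fun x => mem_iUnion.1 (hA.iUnion_eq ▸ mem_univ x)
    choose g hg using hex
    have hfib : ∀ i, g ⁻¹' {i} = A i := by
      refine fun i => Subset.antisymm (fun x hx => ?_) fun x hx => ?_
      · rw [← show g x = i from hx]; exact hg x
      · by_contra hne
        have : x ∈ A (g x) ∩ A i := ⟨hg x, hx⟩
        rw [hA.disjoint _ _ hne] at this
        exact this
    have hpos : ∀ j, 0 < (β • ev A σ) j := fun j => mul_pos hβ (NNReal.coe_pos.2 (hA.pos j))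
    have hsum : ∑ j, (β • ev A σ) j = β := by
      have h1 := sum_measureReal_fiber (fun i => (hfib i).symm ▸ hA.measurableSet i) (σ : Measure X)
      simp only [hfib] at h1
      calc ∑ j, (β • ev A σ) j = β * ∑ j, (σ : Measure X).real (A j) := by
            rw [Finset.mul_sum]; rfl
        _ = β := by rw [h1, mul_one]
    have := isProbabilityMeasure_dirichlet hpos
    have hm := measurable_ev hA.measurableSet
    have := Measure.isProbabilityMeasure_map (μ := (D : Measure (ProbabilityMeasure X)))
      hm.aemeasurable
    refine Measure.ext_of_integral_monomial ?_ (dirichlet_ae_mem_Icc _) fun n => ?_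
    · have hS : MeasurableSet {y : Fin (m + 1) → ℝ | ∀ i, y i ∈ Icc (0 : ℝ) 1} := by
        rw [ofPred_forall]
        exact MeasurableSet.iInter fun i => measurable_pi_apply i measurableSet_Icc
      rw [ae_map_iff hm.aemeasurable hS]
      exact ae_of_all _ fun η i => measureReal_fiber_mem_Icc η (A i)
    · have h1 := h (Fin (m + 1)) g (fun i => (hfib i).symm ▸ hA.measurableSet i) n
      simp only [hfib] at h1
      rw [integral_dirichlet_monomial hpos, hsum, integral_map hm.aemeasurable
        (Measurable.aestronglyMeasurable (by fun_prop))]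
      exact h1
  -- The first moment of `η N` is `σ N = 0`, and a nonnegative function with zero integral vanishes
  -- almost everywhere.
  · let g : X → Bool := fun x => decide (x ∈ N)
    have hN1 : g ⁻¹' {true} = N := by ext x; simp [g]
    have hN2 : g ⁻¹' {false} = Nᶜ := by ext x; simp [g]
    have h1 := h Bool g (fun i => by cases i <;> simp [hN1, hN2, hN]) fun i => if i then 1 else 0
    have h0 : (σ : Measure X).real N = 0 := NNReal.coe_eq_zero.2 hσN
    simp only [Fintype.prod_bool, hN1, hN2, h0, mul_zero] at h1
    simp only [if_true, pow_one, risingFactorial_zero_left_eq_pow, zero_mul, zero_div,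
      Bool.false_eq_true, if_false, pow_zero, mul_one] at h1
    rw [integral_eq_zero_iff_of_nonneg (fun η => measureReal_nonneg)] at h1
    · filter_upwards [h1] with η hη
      exact NNReal.coe_eq_zero.1 hη
    · exact Integrable.of_bound (measurable_real_apply hN).aestronglyMeasurable 1
        (ae_of_all _ fun η => by
          rw [Real.norm_of_nonneg measureReal_nonneg]; exact measureReal_le_one)

/-- A random probability measure is determined by the joint laws of its evaluations on the fibres
of maps to finite types. -/
theorem HasDirichletMoments.unique {β : ℝ} {σ : ProbabilityMeasure X}
    {D E : ProbabilityMeasure (ProbabilityMeasure X)} (hD : HasDirichletMoments β σ D)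
    (hE : HasDirichletMoments β σ E) : D = E := by
  classical
  let J : ProbabilityMeasure X → ({A : Set X // MeasurableSet A} → ℝ) :=
    fun η A => (η : Measure X).real A.1
  have hJ : Measurable J := measurable_pi_lambda _ fun A => measurable_real_apply A.2
  have hmap : (D : Measure (ProbabilityMeasure X)).map J = (E : Measure _).map J := by
    have hfin : ∀ I : Finset {A : Set X // MeasurableSet A},
        ((D : Measure (ProbabilityMeasure X)).map J).map I.restrict
          = ((E : Measure _).map J).map I.restrict := by
      intro I
      let e := I.equivFin
      -- Membership patterns index the atoms of the algebra generated by the sets in `I`. Passing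
      -- through `Fin` keeps `κ` in `Type`, as `HasDirichletMoments` demands.
      let κ := Fin I.card → Bool
      let g : X → κ := fun x i => decide (x ∈ (e.symm i).1.1)
      have hg : ∀ c, MeasurableSet (g ⁻¹' {c}) := by
        intro c
        have : g ⁻¹' {c} = ⋂ i, {x | g x i = c i} := by
          ext x
          simp only [mem_preimage, mem_singleton_iff, mem_iInter, mem_ofPred_eq]
          exact funext_iff
        rw [this]
        refine MeasurableSet.iInter fun i => ?_
        cases c i
        · convert (e.symm i).1.2.compl using 1; ext x; simp [g]
        · convert (e.symm i).1.2 using 1; ext x; simp [g]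
      -- Each set in `I` is the disjoint union of the atoms whose pattern contains it, so the
      -- evaluations are linear in the atom masses.
      let L : (κ → ℝ) → (I → ℝ) := fun y s => ∑ c : κ with c (e s) = true, y c
      have hL : Measurable L := measurable_pi_lambda _ fun s => by fun_prop
      let F : ProbabilityMeasure X → (κ → ℝ) := fun η c => (η : Measure X).real (g ⁻¹' {c})
      have hF : Measurable F := measurable_pi_lambda _ fun c => measurable_real_apply (hg c)
      have hcomp : I.restrict ∘ J = L ∘ F := by
        funext η s
        simp only [L, F, Function.comp_apply]
        rw [← measureReal_preimage_eq_sum hg]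
        simp only [J, Finset.restrict]
        congr 1
        ext x
        simp [g]
      have hS : MeasurableSet {y : κ → ℝ | ∀ i, y i ∈ Icc (0 : ℝ) 1} := by
        rw [ofPred_forall]
        exact MeasurableSet.iInter fun i => measurable_pi_apply i measurableSet_Icc
      have hFeq : (D : Measure (ProbabilityMeasure X)).map F = (E : Measure _).map F := by
        have := Measure.isProbabilityMeasure_map (μ := (D : Measure (ProbabilityMeasure X)))
          hF.aemeasurable
        have := Measure.isProbabilityMeasure_map (μ := (E : Measure (ProbabilityMeasure X)))
          hF.aemeasurable
        refine Measure.ext_of_integral_monomial ?_ ?_ fun n => ?_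
        · rw [ae_map_iff hF.aemeasurable hS]
          exact ae_of_all _ fun η i => measureReal_fiber_mem_Icc η _
        · rw [ae_map_iff hF.aemeasurable hS]
          exact ae_of_all _ fun η i => measureReal_fiber_mem_Icc η _
        · rw [integral_map hF.aemeasurable (Measurable.aestronglyMeasurable (by fun_prop)),
            integral_map hF.aemeasurable (Measurable.aestronglyMeasurable (by fun_prop))]
          exact (hD κ g hg n).trans (hE κ g hg n).symm
      rw [Measure.map_map (by fun_prop) hJ, Measure.map_map (by fun_prop) hJ, hcomp,
        ← Measure.map_map hL hF, ← Measure.map_map hL hF, hFeq]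
    have := Measure.isProbabilityMeasure_map (μ := (E : Measure (ProbabilityMeasure X)))
      hJ.aemeasurable
    let P (I : Finset {A : Set X // MeasurableSet A}) : Measure (I → ℝ) :=
      ((E : Measure (ProbabilityMeasure X)).map J).map I.restrict
    have hP : ∀ I, IsFiniteMeasure (P I) := fun I => Measure.isFiniteMeasure_map _ _
    exact IsProjectiveLimit.unique (α := fun _ => ℝ) (P := P) hfin fun I => rfl
  -- The evaluations generate the σ-algebra, so equality of the laws of `J` gives equality of the
  -- measures.
  have hle : (inferInstance : MeasurableSpace (ProbabilityMeasure X))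
      ≤ MeasurableSpace.comap J inferInstance := by
    let _ : MeasurableSpace (ProbabilityMeasure X) := MeasurableSpace.comap J inferInstance
    have hJ' : Measurable J := comap_measurable J
    refine Measurable.comap_le (Measure.measurable_of_measurable_coe _ fun A hA => ?_)
    have : (fun η : ProbabilityMeasure X => (η : Measure X) A)
        = fun η => ENNReal.ofReal (J η ⟨A, hA⟩) := by
      funext η
      simp [J]
    change Measurable fun η : ProbabilityMeasure X => (η : Measure X) A
    rw [this]
    exact ((measurable_pi_apply _).comp hJ').ennreal_ofReal
  have hDE : (D : Measure (ProbabilityMeasure X)) = (E : Measure (ProbabilityMeasure X)) := by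
    refine Measure.ext fun S hS => ?_
    obtain ⟨T, hT, rfl⟩ := hle S hS
    rw [← Measure.map_apply hJ hT, ← Measure.map_apply hJ hT, hmap]
  exact Subtype.ext hDE

end MomentCharacterisation

/-! ### Stick-breaking weights, atoms and self-similarity. -/

section StickBreaking

/-- The Beta distribution with parameters `1` and `β`, as a measure on the unit interval. -/
noncomputable def stickLaw (β : ℝ) : Measure unitInterval :=
  (ProbabilityTheory.betaMeasure 1 β).map (projIcc 0 1 zero_le_one)

theorem isProbabilityMeasure_stickLaw {β : ℝ} (hβ : 0 < β) :
    IsProbabilityMeasure (stickLaw β) := by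
  have := ProbabilityTheory.isProbabilityMeasureBeta one_pos hβ
  exact Measure.isProbabilityMeasure_map continuous_projIcc.measurable.aemeasurable

theorem integral_betaPDFReal {a b : ℝ} (ha : 0 < a) (hb : 0 < b) :
    ∫ t, ProbabilityTheory.betaPDFReal a b t = 1 := by
  rw [integral_eq_lintegral_of_nonneg_ae]
  · have := ProbabilityTheory.lintegral_betaPDF_eq_one ha hb
    simp only [ProbabilityTheory.betaPDF] at this
    rw [this, ENNReal.toReal_one]
  · refine ae_of_all _ fun t => ?_
    by_cases ht : 0 < t ∧ t < 1
    · exact (ProbabilityTheory.betaPDFReal_pos ht.1 ht.2 ha hb).le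
    · simp [ProbabilityTheory.betaPDFReal, ht]
  · exact (ProbabilityTheory.measurable_betaPDFReal a b).aestronglyMeasurable

/-- The monomial turns the Beta(1, β) density into a multiple of the Beta(1 + j, β + l) density,
which integrates to one. -/
theorem integral_stickLaw_monomial {β : ℝ} (hβ : 0 < β) (j l : ℕ) :
    ∫ v, (v : ℝ) ^ j * (1 - v) ^ l ∂stickLaw β
      = j.factorial * β * risingFactorial β l / risingFactorial β (j + l + 1) := by
  have hB := ProbabilityTheory.beta_pos one_pos hβ
  have hj : (0 : ℝ) < 1 + j := by positivity
  have hl : (0 : ℝ) < β + l := by positivity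
  have hB' := ProbabilityTheory.beta_pos hj hl
  have hc : Continuous fun v : unitInterval => (v : ℝ) ^ j * (1 - v) ^ l := by fun_prop
  have hm : Measurable (ProbabilityTheory.betaPDF 1 β) :=
    (ProbabilityTheory.measurable_betaPDFReal 1 β).ennreal_ofReal
  rw [stickLaw, integral_map continuous_projIcc.measurable.aemeasurable
    hc.aestronglyMeasurable, ProbabilityTheory.betaMeasure,
    integral_withDensity_eq_integral_toReal_smul₀ hm.aemeasurable
      (ae_of_all _ fun t => ENNReal.ofReal_lt_top)]
  have hcongr : ∀ t : ℝ, (ProbabilityTheory.betaPDF 1 β t).toReal •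
      ((projIcc (0 : ℝ) 1 zero_le_one t : ℝ) ^ j * (1 - (projIcc (0 : ℝ) 1 zero_le_one t : ℝ)) ^ l)
      = ProbabilityTheory.beta (1 + j) (β + l) / ProbabilityTheory.beta 1 β
        * ProbabilityTheory.betaPDFReal (1 + j) (β + l) t := by
    intro t
    by_cases ht : 0 < t ∧ t < 1
    · have h1 : 0 < 1 - t := by linarith [ht.2]
      rw [projIcc_of_mem _ (⟨ht.1.le, ht.2.le⟩ : t ∈ Icc (0 : ℝ) 1), ProbabilityTheory.betaPDF,
        ENNReal.toReal_ofReal (ProbabilityTheory.betaPDFReal_pos ht.1 ht.2 one_pos hβ).le,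
        ProbabilityTheory.betaPDFReal, ProbabilityTheory.betaPDFReal, if_pos ht, if_pos ht,
        ← rpow_sub_one_mul_pow one_pos ht.1.le j, ← rpow_sub_one_mul_pow hβ h1.le l, smul_eq_mul]
      field_simp
    · simp [ProbabilityTheory.betaPDF, ProbabilityTheory.betaPDFReal, ht]
  rw [integral_congr_ae (ae_of_all _ hcongr), integral_const_mul, integral_betaPDFReal hj hl,
    mul_one, ProbabilityTheory.beta, ProbabilityTheory.beta, Gamma_add_natCast hβ,
    show (1 : ℝ) + j + (β + l) = β + ((j + l + 1 : ℕ) : ℝ) by push_cast; ring,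
    Gamma_add_natCast hβ, add_comm (1 : ℝ) j, Real.Gamma_nat_eq_factorial, Real.Gamma_one,
    add_comm 1 β, Real.Gamma_add_one hβ.ne']
  have h1 := (Real.Gamma_pos_of_pos hβ).ne'
  have h2 := (risingFactorial_pos hβ (j + l + 1)).ne'
  field_simp

/-- The stick-breaking weights `v k * ∏ j < k, (1 - v j)`. -/
noncomputable def stickWeight (v : ℕ → unitInterval) (k : ℕ) : ℝ :=
  v k * ∏ j ∈ Finset.range k, (1 - (v j : ℝ))

theorem stickWeight_nonneg (v : ℕ → unitInterval) (k : ℕ) : 0 ≤ stickWeight v k :=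
  mul_nonneg (v k).2.1 (Finset.prod_nonneg fun j _ => sub_nonneg.2 (v j).2.2)

theorem sum_stickWeight (v : ℕ → unitInterval) (n : ℕ) :
    ∑ k ∈ Finset.range n, stickWeight v k = 1 - ∏ j ∈ Finset.range n, (1 - (v j : ℝ)) := by
  induction n with
  | zero => simp
  | succ n ih => rw [Finset.sum_range_succ, ih, Finset.prod_range_succ, stickWeight]; ring

theorem sum_stickWeight_le_one (v : ℕ → unitInterval) (n : ℕ) :
    ∑ k ∈ Finset.range n, stickWeight v k ≤ 1 := by
  rw [sum_stickWeight]
  linarith [Finset.prod_nonneg fun j (_ : j ∈ Finset.range n) => sub_nonneg.2 (v j).2.2]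

theorem summable_stickWeight (v : ℕ → unitInterval) : Summable (stickWeight v) :=
  summable_of_sum_range_le (stickWeight_nonneg v) (sum_stickWeight_le_one v)

theorem stickWeight_zero (v : ℕ → unitInterval) : stickWeight v 0 = v 0 := by simp [stickWeight]

/-- What remains after the first break is again a broken stick, scaled by `1 - v 0`. -/
theorem stickWeight_succ (v : ℕ → unitInterval) (k : ℕ) :
    stickWeight v (k + 1) = (1 - (v 0 : ℝ)) * stickWeight (fun j => v (j + 1)) k := by
  rw [stickWeight, stickWeight, Finset.prod_range_succ']
  ring

theorem measurable_stickWeight (k : ℕ) : Measurable fun v => stickWeight v k := by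
  unfold stickWeight
  fun_prop

/-- Prepend a term to a sequence. -/
def natCons {E : Type*} (a : E) (y : ℕ → E) : ℕ → E
  | 0 => a
  | k + 1 => y k

theorem measurable_natCons {E : Type*} [MeasurableSpace E] :
    Measurable fun p : E × (ℕ → E) => natCons p.1 p.2 := by
  refine measurable_pi_lambda _ fun k => ?_
  cases k with
  | zero => exact measurable_fst
  | succ k => exact (measurable_pi_apply k).comp measurable_snd

/-- An i.i.d. sequence stays one when an independent term of the same law is prepended; this is the
source of the distributional equation. -/
theorem measurePreserving_natCons {E : Type*} [MeasurableSpace E] (μ : Measure E)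
    [IsProbabilityMeasure μ] :
    MeasurePreserving (fun p : E × (ℕ → E) => natCons p.1 p.2)
      (μ.prod (Measure.infinitePi fun _ => μ)) (Measure.infinitePi fun _ => μ) := by
  classical
  refine ⟨measurable_natCons, Measure.eq_infinitePi _ fun s t ht => ?_⟩
  let t' : ℕ → Set E := fun i => if i ∈ s then t i else univ
  have ht' : ∀ i, MeasurableSet (t' i) := fun i => by
    by_cases hi : i ∈ s <;> simp [t', hi, ht]
  obtain ⟨N, hN⟩ := s.exists_nat_subset_range
  have hN' : s ⊆ Finset.range (N + 1) := hN.trans (Finset.range_mono N.le_succ)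
  have hprod : ∏ i ∈ s, μ (t i) = ∏ i ∈ Finset.range (N + 1), μ (t' i) := by
    rw [← Finset.prod_subset hN' fun i _ hi => by simp [t', hi]]
    exact Finset.prod_congr rfl fun i hi => by simp [t', hi]
  have hpre : (fun p : E × (ℕ → E) => natCons p.1 p.2) ⁻¹' Set.pi s t
      = t' 0 ×ˢ Set.pi (Finset.range N) fun i => t' (i + 1) := by
    ext ⟨a, y⟩
    have h1 : natCons a y ∈ Set.pi s t ↔ ∀ i < N + 1, natCons a y i ∈ t' i := by
      refine ⟨fun h i _ => ?_, fun h i hi => ?_⟩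
      · by_cases hi : i ∈ s
        · simpa [t', hi] using h i hi
        · simp [t', hi]
      · simpa [t', Finset.mem_coe.1 hi] using h i (Finset.mem_range.1 (hN' hi))
    rw [mem_preimage, h1, Nat.forall_lt_succ_left]
    simp [natCons, Set.mem_pi]
  rw [Measure.map_apply measurable_natCons (MeasurableSet.pi s.countable_toSet fun i _ => ht i),
    hpre, Measure.prod_prod, Measure.infinitePi_pi _ fun i _ => ht' _, hprod,
    Finset.prod_range_succ', mul_comm]

theorem measurePreserving_prodProdProdComm {A B C D : Type*} [MeasurableSpace A]
    [MeasurableSpace B] [MeasurableSpace C] [MeasurableSpace D] (a : Measure A) (b : Measure B)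
    (c : Measure C) (d : Measure D) [SFinite a] [SFinite b] [SFinite c] [SFinite d] :
    MeasurePreserving (fun r : (A × B) × (C × D) => ((r.1.1, r.2.1), (r.1.2, r.2.2)))
      ((a.prod b).prod (c.prod d)) ((a.prod c).prod (b.prod d)) := by
  have h1 := measurePreserving_prodAssoc a b (c.prod d)
  have h2 := (MeasurePreserving.id a).prod (measurePreserving_prodAssoc b c d).symm
  have h3 := (MeasurePreserving.id a).prod
    ((Measure.measurePreserving_swap (μ := b) (ν := c)).prod (MeasurePreserving.id d))
  have h4 := (MeasurePreserving.id a).prod (measurePreserving_prodAssoc c b d)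
  have h5 := (measurePreserving_prodAssoc a c (b.prod d)).symm
  exact h5.comp (h4.comp (h3.comp (h2.comp h1)))

variable {X : Type*}

/-- The mass that the random measure `∑ k, stickWeight v k • δ (x k)` gives to `A`. -/
noncomputable def stickEval (v : ℕ → unitInterval) (x : ℕ → X) (A : Set X) : ℝ :=
  ∑' k, stickWeight v k * A.indicator 1 (x k)

theorem stickWeight_mul_indicator_nonneg (v : ℕ → unitInterval) (x : ℕ → X) (A : Set X) (k : ℕ) :
    0 ≤ stickWeight v k * A.indicator (1 : X → ℝ) (x k) :=
  mul_nonneg (stickWeight_nonneg v k) (indicator_nonneg (fun _ _ => zero_le_one) _)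

theorem stickWeight_mul_indicator_le (v : ℕ → unitInterval) (x : ℕ → X) (A : Set X) (k : ℕ) :
    stickWeight v k * A.indicator (1 : X → ℝ) (x k) ≤ stickWeight v k :=
  mul_le_of_le_one_right (stickWeight_nonneg v k)
    (indicator_le_self' (fun _ _ => zero_le_one) _)

theorem summable_stickEval (v : ℕ → unitInterval) (x : ℕ → X) (A : Set X) :
    Summable fun k => stickWeight v k * A.indicator (1 : X → ℝ) (x k) :=
  (summable_stickWeight v).of_nonneg_of_le (stickWeight_mul_indicator_nonneg v x A)
    (stickWeight_mul_indicator_le v x A)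

theorem stickEval_mem_Icc (v : ℕ → unitInterval) (x : ℕ → X) (A : Set X) :
    stickEval v x A ∈ Icc (0 : ℝ) 1 := by
  refine ⟨tsum_nonneg (stickWeight_mul_indicator_nonneg v x A), ?_⟩
  exact ((summable_stickEval v x A).tsum_le_tsum (stickWeight_mul_indicator_le v x A)
    (summable_stickWeight v)).trans
    ((summable_stickWeight v).tsum_le_of_sum_range_le (sum_stickWeight_le_one v))

theorem stickEval_natCons (a : unitInterval) (v : ℕ → unitInterval) (b : X) (x : ℕ → X)
    (A : Set X) : stickEval (natCons a v) (natCons b x) A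
      = a * A.indicator 1 b + (1 - (a : ℝ)) * stickEval v x A := by
  rw [stickEval, (summable_stickEval _ _ A).tsum_eq_zero_add, stickWeight_zero, stickEval,
    ← tsum_mul_left]
  simp only [stickWeight_succ, mul_assoc]
  rfl

theorem norm_prod_stickEval_le_one {κ : Type*} [Fintype κ] (g : X → κ) (n : κ → ℕ)
    (p : (ℕ → unitInterval) × (ℕ → X)) :
    ‖∏ i, stickEval p.1 p.2 (g ⁻¹' {i}) ^ n i‖ ≤ 1 := by
  have h0 : ∀ i, 0 ≤ stickEval p.1 p.2 (g ⁻¹' {i}) := fun i => (stickEval_mem_Icc _ _ _).1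
  rw [Real.norm_of_nonneg (Finset.prod_nonneg fun i _ => pow_nonneg (h0 i) _)]
  exact Finset.prod_le_one (fun i _ => pow_nonneg (h0 i) _)
    fun i _ => pow_le_one₀ (h0 i) (stickEval_mem_Icc _ _ _).2

variable [MeasurableSpace X]

theorem measurable_stickEval {A : Set X} (hA : MeasurableSet A) :
    Measurable fun p : (ℕ → unitInterval) × (ℕ → X) => stickEval p.1 p.2 A := by
  refine measurable_of_tendsto_metrizable (f := fun n p => ∑ k ∈ Finset.range n,
    stickWeight p.1 k * A.indicator (1 : X → ℝ) (p.2 k)) (fun n => ?_) ?_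
  · refine Finset.measurable_sum _ fun k _ => ?_
    exact ((measurable_stickWeight k).comp measurable_fst).mul
      ((measurable_one.indicator hA).comp ((measurable_pi_apply k).comp measurable_snd))
  · exact tendsto_pi_nhds.2 fun p => (summable_stickEval p.1 p.2 A).hasSum.tendsto_sum_nat

/-- The joint law of the stick-breaking proportions and the atoms. -/
noncomputable def stickPrior (β : ℝ) (σ : ProbabilityMeasure X) :
    Measure ((ℕ → unitInterval) × (ℕ → X)) :=
  (Measure.infinitePi fun _ => stickLaw β).prod (Measure.infinitePi fun _ => (σ : Measure X))

/-- The moments of the masses of the fibres of `g`. -/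
noncomputable def stickMoment (β : ℝ) (σ : ProbabilityMeasure X) {κ : Type*} [Fintype κ]
    (g : X → κ) (n : κ → ℕ) : ℝ :=
  ∫ p, ∏ i, stickEval p.1 p.2 (g ⁻¹' {i}) ^ n i ∂stickPrior β σ

theorem isProbabilityMeasure_stickPrior {β : ℝ} (hβ : 0 < β) (σ : ProbabilityMeasure X) :
    IsProbabilityMeasure (stickPrior β σ) := by
  have := isProbabilityMeasure_stickLaw hβ
  unfold stickPrior
  infer_instance

/-- Fubini after splitting off the first proportion and the first atom: the pair of tails is
independent of them and has the original law. -/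
theorem integral_stickPrior {β : ℝ} (hβ : 0 < β) (σ : ProbabilityMeasure X)
    {f : (ℕ → unitInterval) × (ℕ → X) → ℝ} (hf : Measurable f) (hb : ∀ p, ‖f p‖ ≤ 1) :
    ∫ p, f p ∂stickPrior β σ
      = ∫ q : unitInterval × X, ∫ p, f (natCons q.1 p.1, natCons q.2 p.2) ∂stickPrior β σ
          ∂(stickLaw β).prod (σ : Measure X) := by
  have := isProbabilityMeasure_stickLaw hβ
  have := isProbabilityMeasure_stickPrior hβ σ
  let T : (unitInterval × X) × ((ℕ → unitInterval) × (ℕ → X)) →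
      (ℕ → unitInterval) × (ℕ → X) := fun r => (natCons r.1.1 r.2.1, natCons r.1.2 r.2.2)
  have hT : MeasurePreserving T (((stickLaw β).prod (σ : Measure X)).prod (stickPrior β σ))
      (stickPrior β σ) :=
    ((measurePreserving_natCons (stickLaw β)).prod (measurePreserving_natCons (σ : Measure X))).comp
      (measurePreserving_prodProdProdComm _ _ _ _)
  rw [← hT.map_eq, integral_map hT.measurable.aemeasurable hf.aestronglyMeasurable, hT.map_eq,
    integral_prod]
  exact Integrable.of_bound (hf.comp hT.measurable).aestronglyMeasurable 1
    (ae_of_all _ fun r => hb _)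

end StickBreaking

/-! ### The moment recursion and its unique solution. -/

section StickMoments

/-- The coefficient is the descending factorial of `n`. Splitting off `j = 0` and using `(n +
1).descFactorial (j + 1) = (n + 1) * n.descFactorial j` gives the induction step. -/
theorem sum_choose_mul_risingFactorial (a : ℝ) (n : ℕ) :
    ∑ j ∈ Finset.range (n + 1), (n.choose j : ℝ) * j.factorial * (a * risingFactorial a (n - j))
      = risingFactorial a (n + 1) := by
  have hd : ∀ n j : ℕ, (n.choose j : ℝ) * j.factorial = (n.descFactorial j : ℝ) := fun n j => by
    rw [Nat.descFactorial_eq_factorial_mul_choose]; push_cast; ring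
  simp only [hd]
  induction n with
  | zero => simp [risingFactorial]
  | succ n ih =>
    rw [Finset.sum_range_succ']
    simp only [Nat.succ_descFactorial_succ, Nat.add_sub_add_right, Nat.cast_mul, mul_assoc]
    rw [← Finset.mul_sum, ih, risingFactorial_succ a (n + 1)]
    simp [risingFactorial_succ a n]
    ring

/-- The joint moments of a Dirichlet vector with parameter `β • s`. -/
noncomputable def dirichletMoment {κ : Type*} [Fintype κ] (β : ℝ) (s : κ → ℝ) (n : κ → ℕ) : ℝ :=
  (∏ i, risingFactorial (β * s i) (n i)) / risingFactorial β (∑ i, n i)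

variable {κ : Type*} [Fintype κ] [DecidableEq κ]

theorem sum_update_sub {n : κ → ℕ} {i : κ} {j : ℕ} (hj : j ≤ n i) :
    ∑ l, Function.update n i (n i - j) l + j = ∑ l, n l := by
  rw [Finset.sum_update_of_mem (Finset.mem_univ i), ← Finset.add_sum_erase _ n (Finset.mem_univ i),
    Finset.sdiff_singleton_eq_erase]
  lia

/-- The right-hand side of the moment recursion that corresponds to the distributional equation
`Y = V • e_I + (1 - V) • Y`. -/
noncomputable def momentStep (β : ℝ) (s : κ → ℝ) (M : (κ → ℕ) → ℝ) (n : κ → ℕ) : ℝ :=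
  ∑ i, s i * ∑ j ∈ Finset.range (n i + 1), ((n i).choose j : ℝ)
    * (j.factorial * β * risingFactorial β (∑ l, n l - j) / risingFactorial β (∑ l, n l + 1))
    * M (Function.update n i (n i - j))

/-- By `sum_choose_mul_risingFactorial` the `i`-th summand is a common factor times `β * s i + n i`.
These add up to `β + ∑ l, n l`, the last factor of the rising factorial in the denominator. -/
theorem dirichletMoment_eq_momentStep {β : ℝ} (hβ : 0 < β) {s : κ → ℝ} (hs : ∑ i, s i = 1)
    (n : κ → ℕ) : dirichletMoment β s n = momentStep β s (dirichletMoment β s) n := by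
  have hN := (risingFactorial_pos hβ (∑ l, n l + 1)).ne'
  have hN' := (risingFactorial_pos hβ (∑ l, n l)).ne'
  have hpos : β + (∑ l, n l : ℕ) ≠ 0 := by positivity
  have hterm : ∀ i, s i * ∑ j ∈ Finset.range (n i + 1), ((n i).choose j : ℝ)
      * (j.factorial * β * risingFactorial β (∑ l, n l - j) / risingFactorial β (∑ l, n l + 1))
      * dirichletMoment β s (Function.update n i (n i - j))
      = (∏ l, risingFactorial (β * s l) (n l)) / risingFactorial β (∑ l, n l + 1)
        * (β * s i + n i) := by
    intro i
    have hj : ∀ j ∈ Finset.range (n i + 1), ((n i).choose j : ℝ)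
      * (j.factorial * β * risingFactorial β (∑ l, n l - j) / risingFactorial β (∑ l, n l + 1))
      * dirichletMoment β s (Function.update n i (n i - j))
      = (∏ l ∈ Finset.univ.erase i, risingFactorial (β * s l) (n l))
        / risingFactorial β (∑ l, n l + 1) * ((n i).choose j * j.factorial
          * (β * risingFactorial (β * s i) (n i - j))) := by
      intro j hj
      have hj' : j ≤ n i := Nat.lt_succ_iff.1 (Finset.mem_range.1 hj)
      have hsum : ∑ l, Function.update n i (n i - j) l = ∑ l, n l - j := by
        rw [← sum_update_sub hj', Nat.add_sub_cancel]
      have h1 := (risingFactorial_pos hβ (∑ l, n l - j)).ne'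
      rw [dirichletMoment, hsum, ← Finset.mul_prod_erase _ _ (Finset.mem_univ i),
        Function.update_self, Finset.prod_congr rfl fun l hl => by
          rw [Function.update_of_ne (Finset.ne_of_mem_erase hl)]]
      field_simp
    rw [Finset.sum_congr rfl hj, ← Finset.mul_sum, mul_left_comm, Finset.mul_sum,
      Finset.sum_congr rfl fun j _ => show s i * ((n i).choose j * j.factorial
          * (β * risingFactorial (β * s i) (n i - j))) = (n i).choose j * j.factorial
          * (β * s i * risingFactorial (β * s i) (n i - j)) by ring,
      sum_choose_mul_risingFactorial, risingFactorial_succ _ (n i),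
      ← Finset.mul_prod_erase _ _ (Finset.mem_univ i)]
    ring
  rw [momentStep, Finset.sum_congr rfl fun i _ => hterm i, ← Finset.mul_sum,
    Finset.sum_add_distrib, ← Finset.mul_sum, hs, dirichletMoment, ← Nat.cast_sum,
    risingFactorial_succ]
  field_simp

/-- Induction on the total degree `N`: terms with `j > 0` have lower degree, and those with `j = 0`
reproduce `M n` with total coefficient `β / (β + N) < 1`. Hence the difference of two solutions is
zero. -/
theorem eq_dirichletMoment_of_eq_momentStep {β : ℝ} (hβ : 0 < β) {s : κ → ℝ} (hs : ∑ i, s i = 1)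
    {M : (κ → ℕ) → ℝ} (h0 : M 0 = 1) (hM : ∀ n, M n = momentStep β s M n) (n : κ → ℕ) :
    M n = dirichletMoment β s n := by
  induction hN : ∑ l, n l using Nat.strong_induction_on generalizing n with
  | _ N ih =>
  by_cases hn : n = 0
  · subst hn
    simp [h0, dirichletMoment, risingFactorial_zero]
  have hNpos : 0 < N := by
    by_contra h
    refine hn (funext fun i => ?_)
    have := Finset.single_le_sum (fun j _ => Nat.zero_le (n j)) (Finset.mem_univ i)
    simp only [Pi.zero_apply]
    lia
  have hd := congrArg₂ (· - ·) (hM n) (dirichletMoment_eq_momentStep hβ hs n)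
  have hstep : momentStep β s M n - momentStep β s (dirichletMoment β s) n
      = β / (β + N) * (M n - dirichletMoment β s n) := by
    rw [momentStep, momentStep, ← Finset.sum_sub_distrib]
    have hi : ∀ i, s i * (∑ j ∈ Finset.range (n i + 1), ((n i).choose j : ℝ)
        * (j.factorial * β * risingFactorial β (∑ l, n l - j) / risingFactorial β (∑ l, n l + 1))
        * M (Function.update n i (n i - j)))
        - s i * (∑ j ∈ Finset.range (n i + 1), ((n i).choose j : ℝ)
        * (j.factorial * β * risingFactorial β (∑ l, n l - j) / risingFactorial β (∑ l, n l + 1))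
        * dirichletMoment β s (Function.update n i (n i - j)))
        = s i * (β / (β + N) * (M n - dirichletMoment β s n)) := by
      intro i
      rw [← mul_sub, ← Finset.sum_sub_distrib, Finset.sum_eq_single 0]
      · have h1 := (risingFactorial_pos hβ N).ne'
        have h2 : β + (N : ℝ) ≠ 0 := by positivity
        simp only [Nat.choose_zero_right, Nat.factorial_zero, Nat.sub_zero,
          Function.update_eq_self, hN, risingFactorial_succ]
        field_simp
        simp
      · intro j hj hj0
        have hj' : j ≤ n i := Nat.lt_succ_iff.1 (Finset.mem_range.1 hj)
        have hlt : ∑ l, Function.update n i (n i - j) l < N := by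
          have := sum_update_sub hj'
          lia
        rw [ih _ hlt _ rfl, sub_self]
      · simp
    rw [Finset.sum_congr rfl fun i _ => hi i, ← Finset.sum_mul, hs, one_mul]
  rw [hstep] at hd
  have hN1 : (0 : ℝ) < N := Nat.cast_pos.2 hNpos
  have hlt : β / (β + N) < 1 := (div_lt_one (by positivity)).2 (by linarith)
  have : (1 - β / (β + N)) * (M n - dirichletMoment β s n) = 0 := by linarith
  rcases mul_eq_zero.1 this with h | h
  · linarith
  · linarith

variable {X : Type*}

theorem stickEval_univ (v : ℕ → unitInterval) (x : ℕ → X) :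
    stickEval v x univ = ∑' k, stickWeight v k := by
  simp [stickEval]

/-- Only the fibre containing the new atom `b` gains mass, so the binomial theorem is needed for
that factor alone; the others just scale by `1 - a`. -/
theorem prod_stickEval_natCons (g : X → κ) (n : κ → ℕ) (a : unitInterval) (b : X)
    (v : ℕ → unitInterval) (x : ℕ → X) :
    ∏ i, stickEval (natCons a v) (natCons b x) (g ⁻¹' {i}) ^ n i
      = ∑ j ∈ Finset.range (n (g b) + 1), ((n (g b)).choose j : ℝ)
        * ((a : ℝ) ^ j * (1 - a) ^ (∑ l, n l - j))
        * ∏ i, stickEval v x (g ⁻¹' {i}) ^ Function.update n (g b) (n (g b) - j) i := by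
  have hne : ∀ i ∈ Finset.univ.erase (g b),
      stickEval (natCons a v) (natCons b x) (g ⁻¹' {i}) ^ n i
        = (1 - (a : ℝ)) ^ n i * stickEval v x (g ⁻¹' {i}) ^ n i := fun i hi => by
    have : b ∉ g ⁻¹' {i} := fun h => Finset.ne_of_mem_erase hi (Eq.symm h)
    rw [stickEval_natCons, indicator_of_notMem this, mul_zero, zero_add, mul_pow]
  have hb : b ∈ g ⁻¹' {g b} := rfl
  rw [← Finset.mul_prod_erase _ _ (Finset.mem_univ (g b)), Finset.prod_congr rfl hne,
    stickEval_natCons, indicator_of_mem hb, Pi.one_apply, mul_one, add_pow, Finset.sum_mul]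
  refine Finset.sum_congr rfl fun j hj => ?_
  have hj' : j ≤ n (g b) := Nat.lt_succ_iff.1 (Finset.mem_range.1 hj)
  have hsum : ∑ l, n l - j = (n (g b) - j) + ∑ i ∈ Finset.univ.erase (g b), n i := by
    rw [← Finset.add_sum_erase _ n (Finset.mem_univ (g b))]
    lia
  have hupd : ∀ i ∈ Finset.univ.erase (g b),
      stickEval v x (g ⁻¹' {i}) ^ Function.update n (g b) (n (g b) - j) i
        = stickEval v x (g ⁻¹' {i}) ^ n i := fun i hi => by
    rw [Function.update_of_ne (Finset.ne_of_mem_erase hi)]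
  rw [← Finset.mul_prod_erase _ _ (Finset.mem_univ (g b)), Function.update_self,
    Finset.prod_congr rfl hupd, Finset.prod_mul_distrib, Finset.prod_pow_eq_pow_sum, hsum, pow_add, mul_pow]
  ring

variable [MeasurableSpace X] {β : ℝ}

theorem stickMoment_eq_momentStep (hβ : 0 < β) (σ : ProbabilityMeasure X) {g : X → κ}
    (hg : ∀ i, MeasurableSet (g ⁻¹' {i})) (n : κ → ℕ) :
    stickMoment β σ g n
      = momentStep β (fun i => (σ : Measure X).real (g ⁻¹' {i})) (stickMoment β σ g) n := by
  have := isProbabilityMeasure_stickLaw hβ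
  have := isProbabilityMeasure_stickPrior hβ σ
  have hmeas : ∀ n : κ → ℕ, Measurable fun p : (ℕ → unitInterval) × (ℕ → X) =>
      ∏ i, stickEval p.1 p.2 (g ⁻¹' {i}) ^ n i := fun n =>
    Finset.measurable_prod _ fun i _ => (measurable_stickEval (hg i)).pow_const _
  have hint : ∀ n : κ → ℕ, Integrable (fun p : (ℕ → unitInterval) × (ℕ → X) =>
      ∏ i, stickEval p.1 p.2 (g ⁻¹' {i}) ^ n i) (stickPrior β σ) := fun n =>
    Integrable.of_bound (hmeas n).aestronglyMeasurable 1
      (ae_of_all _ (norm_prod_stickEval_le_one g n))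
  let H : κ → unitInterval → ℝ := fun i a => ∑ j ∈ Finset.range (n i + 1), ((n i).choose j : ℝ)
    * ((a : ℝ) ^ j * (1 - a) ^ (∑ l, n l - j)) * stickMoment β σ g (Function.update n i (n i - j))
  have hHc : ∀ i, Continuous (H i) := fun i => by fun_prop
  have hHi : ∀ i, Integrable (H i) (stickLaw β) := fun i =>
    (hHc i).integrable_of_hasCompactSupport (HasCompactSupport.of_compactSpace _)
  -- Writing the dependence on the atom through indicators of the fibres separates the variables, so
  -- the outer integral factorises.
  have hinner : ∀ q : unitInterval × X,
      ∫ p, ∏ i, stickEval (natCons q.1 p.1) (natCons q.2 p.2) (g ⁻¹' {i}) ^ n i ∂stickPrior β σ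
        = ∑ i, H i q.1 * (g ⁻¹' {i}).indicator 1 q.2 := by
    intro q
    simp only [prod_stickEval_natCons]
    rw [integral_finsetSum _ fun j _ => (hint _).const_mul _]
    refine Eq.trans ?_ (Finset.sum_eq_single (g q.2) (fun i _ hi => ?_) (by simp)).symm
    · have hb : q.2 ∈ g ⁻¹' {g q.2} := rfl
      simp only [integral_const_mul, indicator_of_mem hb, Pi.one_apply, mul_one, H]
      rfl
    · have : q.2 ∉ g ⁻¹' {i} := fun h => hi (Eq.symm h)
      rw [indicator_of_notMem this, mul_zero]
  have hind : ∀ i, Integrable ((g ⁻¹' {i}).indicator (1 : X → ℝ)) (σ : Measure X) := fun i =>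
    (integrable_const (1 : ℝ)).indicator (hg i)
  rw [stickMoment, integral_stickPrior hβ σ (hmeas n) (norm_prod_stickEval_le_one g n)]
  simp only [hinner]
  rw [integral_finsetSum _ fun i _ => (hHi i).mul_prod (hind i), momentStep]
  refine Finset.sum_congr rfl fun i _ => ?_
  rw [integral_prod_mul (H i), integral_indicator_one (hg i), mul_comm]
  congr 1
  rw [integral_finsetSum]
  · refine Finset.sum_congr rfl fun j hj => ?_
    have hj' : j ≤ ∑ l, n l := (Nat.lt_succ_iff.1 (Finset.mem_range.1 hj)).trans
      (Finset.single_le_sum (fun l _ => Nat.zero_le (n l)) (Finset.mem_univ i))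
    rw [integral_mul_const, integral_const_mul, integral_stickLaw_monomial hβ,
      Nat.add_sub_of_le hj']
  · exact fun j _ => Continuous.integrable_of_hasCompactSupport (by fun_prop)
      (HasCompactSupport.of_compactSpace _)

theorem stickMoment_eq (hβ : 0 < β) (σ : ProbabilityMeasure X) {g : X → κ}
    (hg : ∀ i, MeasurableSet (g ⁻¹' {i})) (n : κ → ℕ) :
    stickMoment β σ g n
      = dirichletMoment β (fun i => (σ : Measure X).real (g ⁻¹' {i})) n := by
  have := isProbabilityMeasure_stickPrior hβ σ
  refine eq_dirichletMoment_of_eq_momentStep hβ (sum_measureReal_fiber hg _) ?_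
    (stickMoment_eq_momentStep hβ σ hg) n
  simp [stickMoment]

/-- The total mass is at most one, and the moment formula for a constant map gives it mean one. -/
theorem ae_tsum_stickWeight_eq_one (hβ : 0 < β) (σ : ProbabilityMeasure X) :
    ∀ᵐ v ∂Measure.infinitePi fun _ : ℕ => stickLaw β, ∑' k, stickWeight v k = 1 := by
  have := isProbabilityMeasure_stickLaw hβ
  have := isProbabilityMeasure_stickPrior hβ σ
  have h := stickMoment_eq hβ σ (g := fun _ : X => ()) (fun i => by simp) 1
  have hpre : ∀ u : Unit, (fun _ : X => ()) ⁻¹' {u} = univ := fun u => by simp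
  simp only [stickMoment, dirichletMoment, hpre, Finset.univ_unique, Finset.prod_singleton,
    Finset.sum_singleton, probReal_univ, mul_one, Pi.one_apply, pow_one] at h
  rw [div_self (risingFactorial_pos hβ 1).ne'] at h
  have hI : Integrable (fun p : (ℕ → unitInterval) × (ℕ → X) => stickEval p.1 p.2 univ)
      (stickPrior β σ) :=
    Integrable.of_bound (measurable_stickEval MeasurableSet.univ).aestronglyMeasurable 1
      (ae_of_all _ fun p => by
        rw [Real.norm_of_nonneg (stickEval_mem_Icc _ _ _).1]
        exact (stickEval_mem_Icc _ _ _).2)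
  have h1 : ∫ p, (1 - stickEval p.1 p.2 univ) ∂stickPrior β σ = 0 := by
    rw [integral_sub (integrable_const _) hI, h]
    simp
  rw [integral_eq_zero_iff_of_nonneg (fun p => sub_nonneg.2 (stickEval_mem_Icc _ _ _).2)
    ((integrable_const _).sub hI)] at h1
  have h2 : ∀ᵐ p ∂stickPrior β σ, ∑' k, stickWeight p.1 k = 1 := by
    filter_upwards [h1] with p hp
    rw [← stickEval_univ p.1 p.2]
    have : 1 - stickEval p.1 p.2 univ = 0 := hp
    linarith
  have h3 := Measure.ae_ae_of_ae_prod h2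
  filter_upwards [h3] with v hv
  simpa using hv

end StickMoments

/-! ### The stick-breaking random measure as a Dirichlet–Ferguson measure. -/

section RandomMeasure

variable {X : Type*} [MeasurableSpace X] {β : ℝ}

open Classical in
/-- The random measure `∑ k, stickWeight v k • δ (x k)` (and `δ (x 0)` if the weights do not sum
to one). -/
noncomputable def stickMeasure (p : (ℕ → unitInterval) × (ℕ → X)) : Measure X :=
  if ∑' k, stickWeight p.1 k = 1 then
    Measure.sum fun k => ENNReal.ofReal (stickWeight p.1 k) • Measure.dirac (p.2 k)
  else Measure.dirac (p.2 0)

theorem stickMeasure_apply {p : (ℕ → unitInterval) × (ℕ → X)}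
    (hp : ∑' k, stickWeight p.1 k = 1) {A : Set X} (hA : MeasurableSet A) :
    stickMeasure p A = ENNReal.ofReal (stickEval p.1 p.2 A) := by
  rw [stickMeasure, if_pos hp, Measure.sum_apply _ hA, stickEval,
    ENNReal.ofReal_tsum_of_nonneg (stickWeight_mul_indicator_nonneg _ _ _)
      (summable_stickEval _ _ _)]
  refine tsum_congr fun k => ?_
  rw [ENNReal.ofReal_mul (stickWeight_nonneg _ _), Measure.smul_apply, Measure.dirac_apply' _ hA,
    smul_eq_mul]
  congr 1
  by_cases h : p.2 k ∈ A <;> simp [h]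

theorem isProbabilityMeasure_stickMeasure (p : (ℕ → unitInterval) × (ℕ → X)) :
    IsProbabilityMeasure (stickMeasure p) := by
  by_cases hp : ∑' k, stickWeight p.1 k = 1
  · refine ⟨?_⟩
    rw [stickMeasure_apply hp MeasurableSet.univ, stickEval_univ, hp, ENNReal.ofReal_one]
  · rw [stickMeasure, if_neg hp]
    infer_instance

/-- `stickMeasure` as a probability measure. -/
noncomputable def stickProbability (p : (ℕ → unitInterval) × (ℕ → X)) : ProbabilityMeasure X :=
  ⟨stickMeasure p, isProbabilityMeasure_stickMeasure p⟩

theorem measurable_stickProbability :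
    Measurable (stickProbability : (ℕ → unitInterval) × (ℕ → X) → ProbabilityMeasure X) := by
  classical
  refine Measurable.subtype_mk (Measure.measurable_of_measurable_coe _ fun A hA => ?_)
  have hS : MeasurableSet {p : (ℕ → unitInterval) × (ℕ → X) | ∑' k, stickWeight p.1 k = 1} := by
    have : {p : (ℕ → unitInterval) × (ℕ → X) | ∑' k, stickWeight p.1 k = 1}
        = (fun p => stickEval p.1 p.2 univ) ⁻¹' {1} := by
      ext p
      rw [mem_preimage, stickEval_univ]
      rfl
    rw [this]
    exact measurable_stickEval MeasurableSet.univ (measurableSet_singleton 1)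
  have heq : (fun p : (ℕ → unitInterval) × (ℕ → X) => stickMeasure p A)
      = fun p => if ∑' k, stickWeight p.1 k = 1 then ENNReal.ofReal (stickEval p.1 p.2 A)
        else A.indicator 1 (p.2 0) := by
    funext p
    by_cases hp : ∑' k, stickWeight p.1 k = 1
    · rw [if_pos hp, stickMeasure_apply hp hA]
    · rw [if_neg hp, stickMeasure, if_neg hp, Measure.dirac_apply' _ hA]
  rw [heq]
  exact Measurable.ite hS (measurable_stickEval hA).ennreal_ofReal
    ((measurable_one.indicator hA).comp ((measurable_pi_apply 0).comp measurable_snd))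

/-- The law of the stick-breaking random measure. -/
noncomputable def stickBreaking (hβ : 0 < β) (σ : ProbabilityMeasure X) :
    ProbabilityMeasure (ProbabilityMeasure X) :=
  ⟨(stickPrior β σ).map stickProbability, by
    have := isProbabilityMeasure_stickPrior hβ σ
    exact Measure.isProbabilityMeasure_map measurable_stickProbability.aemeasurable⟩

theorem ae_stickPrior_tsum_stickWeight_eq_one (hβ : 0 < β) (σ : ProbabilityMeasure X) :
    ∀ᵐ p ∂stickPrior β σ, ∑' k, stickWeight p.1 k = 1 := by
  have := isProbabilityMeasure_stickLaw hβ
  exact Measure.quasiMeasurePreserving_fst.ae (ae_tsum_stickWeight_eq_one hβ σ)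

theorem hasDirichletMoments_stickBreaking (hβ : 0 < β) (σ : ProbabilityMeasure X) :
    HasDirichletMoments β σ (stickBreaking hβ σ) := by
  classical
  intro κ _ g hg n
  have hm : Measurable fun η : ProbabilityMeasure X =>
      ∏ i, (η : Measure X).real (g ⁻¹' {i}) ^ n i :=
    Finset.measurable_prod _ fun i _ => (measurable_real_apply (hg i)).pow_const _
  refine Eq.trans ?_ (stickMoment_eq hβ σ hg n)
  refine (integral_map measurable_stickProbability.aemeasurable hm.aestronglyMeasurable).trans
    (integral_congr_ae ?_)
  filter_upwards [ae_stickPrior_tsum_stickWeight_eq_one hβ σ] with p hp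
  refine Finset.prod_congr rfl fun i _ => ?_
  congr 1
  change (stickMeasure p (g ⁻¹' {i})).toReal = _
  rw [stickMeasure_apply hp (hg i), ENNReal.toReal_ofReal (stickEval_mem_Icc _ _ _).1]

/-- The first moment of `η A` is `β * σ A / β`. -/
theorem HasDirichletMoments.barycenter_eq (hβ : 0 < β) {σ : ProbabilityMeasure X}
    {D : ProbabilityMeasure (ProbabilityMeasure X)} (h : HasDirichletMoments β σ D) :
    barycenter D = σ := by
  classical
  refine Subtype.ext (Measure.ext fun A hA => ?_)
  let g : X → Bool := fun x => decide (x ∈ A)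
  have h1 : g ⁻¹' {true} = A := by ext x; simp [g]
  have h2 : g ⁻¹' {false} = Aᶜ := by ext x; simp [g]
  have hM := h Bool g (fun i => by cases i <;> simp [h1, h2, hA]) fun i => if i then 1 else 0
  simp only [Fintype.prod_bool, Fintype.sum_bool, h1, if_true, pow_one, Bool.false_eq_true,
    if_false, pow_zero, mul_one, add_zero] at hM
  have hr : ∀ a : ℝ, risingFactorial a 1 = a := fun a => by simp [risingFactorial]
  rw [hr, hr, risingFactorial_zero, mul_one, mul_div_cancel_left₀ _ hβ.ne'] at hM
  have hI : Integrable (fun η : ProbabilityMeasure X => (η : Measure X).real A)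
      (D : Measure (ProbabilityMeasure X)) :=
    Integrable.of_bound (measurable_real_apply hA).aestronglyMeasurable 1
      (ae_of_all _ fun η => by
        rw [Real.norm_of_nonneg measureReal_nonneg]; exact measureReal_le_one)
  have hL := ofReal_integral_eq_lintegral_ofReal hI (ae_of_all _ fun η => measureReal_nonneg)
  rw [hM] at hL
  have hη : ∀ η : ProbabilityMeasure X, ENNReal.ofReal ((η : Measure X).real A)
      = (η : Measure X) A := fun η => ofReal_measureReal
  rw [hη, lintegral_congr hη] at hL
  exact (barycenter_apply D hA).trans hL.symm

theorem isDirichletFerguson_dirichletFerguson {σ : ProbabilityMeasure X}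
    (h : ∃ D, IsDirichletFerguson β σ D) : IsDirichletFerguson β σ (dirichletFerguson β σ) := by
  have : dirichletFerguson β σ = h.choose := dif_pos h
  rw [this]
  exact h.choose_spec

end RandomMeasure

/-! ### Narrow continuity of the stick-breaking law and of the barycenter. -/

section Continuity

variable {X : Type*} [MeasurableSpace X]

/-- The infinite power of a probability measure. -/
noncomputable def infinitePower (σ : ProbabilityMeasure X) : ProbabilityMeasure (ℕ → X) :=
  ⟨Measure.infinitePi fun _ => (σ : Measure X), inferInstance⟩

theorem infinitePower_pi (σ : ProbabilityMeasure X) {s : Finset ℕ} {t : ℕ → Set X}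
    (ht : ∀ i, MeasurableSet (t i)) (hs : ∀ i ∉ s, t i = univ) :
    infinitePower σ (univ.pi t) = ∏ i ∈ s, σ (t i) := by
  have : (univ : Set ℕ).pi t = Set.pi s t := by
    ext x
    simp only [Set.mem_pi, mem_univ, forall_true_left, Finset.mem_coe]
    refine ⟨fun h i _ => h i, fun h i => ?_⟩
    by_cases hi : i ∈ s
    · exact h i hi
    · simp [hs i hi]
  rw [this]
  apply ENNReal.coe_injective
  rw [ProbabilityMeasure.ennreal_coeFn_eq_coeFn_toMeasure, ENNReal.ofNNReal_finsetProd]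
  simp only [ProbabilityMeasure.ennreal_coeFn_eq_coeFn_toMeasure]
  exact Measure.infinitePi_pi _ fun i _ => ht i

variable [TopologicalSpace X] [BorelSpace X]

/-- Integrals of bounded continuous `f` are series `∑ k, stickWeight v k * f (x k)`, which converge
uniformly in `x` by the Weierstrass test. -/
theorem continuous_stickProbability {v : ℕ → unitInterval} (hv : ∑' k, stickWeight v k = 1) :
    Continuous fun x : ℕ → X => stickProbability (v, x) := by
  refine continuous_iff_continuousAt.2 fun x₀ => ?_
  refine ProbabilityMeasure.tendsto_iff_forall_integral_tendsto.2 fun f => ?_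
  have hint : ∀ x : ℕ → X, ∫ a, f a ∂(stickProbability (v, x) : Measure X)
      = ∑' k, stickWeight v k * f (x k) := by
    intro x
    have hI : Integrable f (stickMeasure (v, x)) := by
      have := isProbabilityMeasure_stickMeasure (v, x)
      exact f.integrable _
    change ∫ a, f a ∂stickMeasure (v, x) = _
    rw [stickMeasure, if_pos hv] at hI ⊢
    rw [integral_sum_measure hI]
    refine tsum_congr fun k => ?_
    rw [integral_smul_measure, integral_dirac' _ _ f.continuous.stronglyMeasurable,
      ENNReal.toReal_ofReal (stickWeight_nonneg _ _),
      smul_eq_mul]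
  simp only [hint]
  refine Continuous.tendsto (continuous_tsum (fun k => ?_)
    ((summable_stickWeight v).mul_right ‖f‖) fun k x => ?_) x₀
  · exact continuous_const.mul (f.continuous.comp (continuous_apply k))
  · rw [norm_mul, Real.norm_of_nonneg (stickWeight_nonneg v k)]
    exact mul_le_mul_of_nonneg_left (f.norm_coe_le_norm _) (stickWeight_nonneg v k)

variable [SecondCountableTopology X] [TopologicalSpace.PseudoMetrizableSpace X]

/-- Cylinder boxes whose sides have `σ`-null frontier form a π-system containing small
neighbourhoods of every point of each open set. On such a box the mass is a finite product, and each
factor converges by the portmanteau theorem. -/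
theorem continuous_infinitePower :
    Continuous (infinitePower : ProbabilityMeasure X → ProbabilityMeasure (ℕ → X)) := by
  refine continuous_iff_continuousAt.2 fun σ => ?_
  let S : Set (Set (ℕ → X)) := {A | ∃ (t : ℕ → Set X) (s : Finset ℕ), A = univ.pi t ∧
    (∀ i, MeasurableSet (t i)) ∧ (∀ i ∉ s, t i = univ) ∧
    ∀ i, (σ : Measure X) (frontier (t i)) = 0}
  have hS : IsPiSystem S := by
    rintro - ⟨t, s, rfl, ht, hs, h0⟩ - ⟨t', s', rfl, ht', hs', h0'⟩ -
    classical
    refine ⟨fun i => t i ∩ t' i, s ∪ s', pi_inter_distrib.symm, fun i => (ht i).inter (ht' i),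
      fun i hi => ?_, fun i => null_frontier_inter (h0 i) (h0' i)⟩
    rw [Finset.notMem_union] at hi
    simp [hs i hi.1, hs' i hi.2]
  refine hS.tendsto_probabilityMeasure_of_tendsto_of_mem ?_ ?_ ?_
  · rintro - ⟨t, s, rfl, ht, -⟩
    exact MeasurableSet.univ_pi ht
  · let : PseudoMetricSpace X := TopologicalSpace.pseudoMetrizableSpacePseudoMetric X
    intro u hu x hx
    classical
    obtain ⟨s, v, hv, hsv⟩ := isOpen_pi_iff.1 hu x hx
    have hex : ∀ i ∈ s, ∃ r > 0, Metric.ball (x i) r ⊆ v i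
        ∧ (σ : Measure X) (frontier (Metric.ball (x i) r)) = 0 := by
      intro i hi
      obtain ⟨ε, hε, hb⟩ := Metric.isOpen_iff.1 (hv i hi).1 (x i) (hv i hi).2
      -- Balls with null frontier exist at arbitrarily small radii around any point.
      obtain ⟨r, hr, h0⟩ := exists_null_frontier_thickening (σ : Measure X) {x i} hε
      rw [Metric.thickening_singleton] at h0
      exact ⟨r, hr.1, (Metric.ball_subset_ball hr.2.le).trans hb, h0⟩
    choose! r hr hrv h0 using hex
    let t : ℕ → Set X := fun i => if i ∈ s then Metric.ball (x i) (r i) else univ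
    have htu : univ.pi t = Set.pi s t := by
      ext y
      simp only [Set.mem_pi, mem_univ, forall_true_left, Finset.mem_coe]
      refine ⟨fun h i _ => h i, fun h i => ?_⟩
      by_cases hi : i ∈ s
      · exact h i hi
      · simp [t, hi]
    refine ⟨univ.pi t, ⟨t, s, rfl, fun i => ?_, fun i hi => by simp [t, hi], fun i => ?_⟩, ?_, ?_⟩
    · by_cases hi : i ∈ s <;> simp [t, hi, measurableSet_ball]
    · by_cases hi : i ∈ s
      · simp [t, hi, h0 i hi]
      · simp [t, hi]
    · rw [htu]
      refine (isOpen_set_pi s.finite_toSet fun i hi => ?_).mem_nhds fun i hi => ?_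
      · simp [t, Finset.mem_coe.1 hi, Metric.isOpen_ball]
      · simpa [t, Finset.mem_coe.1 hi] using hr i hi
    · rw [htu]
      refine fun y hy => hsv fun i hi => ?_
      have := hy i hi
      simp only [t, if_pos (Finset.mem_coe.1 hi)] at this
      exact hrv i hi this
  · rintro - ⟨t, s, rfl, ht, hs, h0⟩
    simp only [infinitePower_pi _ ht hs]
    exact tendsto_finsetProd _ fun i _ =>
      ProbabilityMeasure.tendsto_measure_of_null_frontier_of_tendsto tendsto_id
        ((σ.null_iff_toMeasure_null _).2 (h0 i))

/-- Integrating the atoms first leaves an outer integral over a law independent of `σ`. The inner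
integrals converge for almost every `v`, and dominated convergence applies with the bound `‖F‖`. -/
theorem continuous_stickBreaking {β : ℝ} (hβ : 0 < β) :
    Continuous (stickBreaking hβ : ProbabilityMeasure X → _) := by
  have := isProbabilityMeasure_stickLaw hβ
  refine continuous_iff_continuousAt.2 fun σ => ?_
  refine ProbabilityMeasure.tendsto_iff_forall_integral_tendsto.2 fun F => ?_
  have hF : Measurable F := F.continuous.measurable
  have hint : ∀ τ : ProbabilityMeasure X,
      Integrable (fun p => F (stickProbability p)) (stickPrior β τ) := fun τ => by
    have := isProbabilityMeasure_stickPrior hβ τ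
    exact Integrable.of_bound (hF.comp measurable_stickProbability).aestronglyMeasurable ‖F‖
      (ae_of_all _ fun p => F.norm_coe_le_norm _)
  have heq : ∀ τ : ProbabilityMeasure X,
      ∫ η, F η ∂(stickBreaking hβ τ : Measure (ProbabilityMeasure X))
        = ∫ v, ∫ x, F (stickProbability (v, x)) ∂(infinitePower τ : Measure (ℕ → X))
          ∂Measure.infinitePi fun _ : ℕ => stickLaw β := fun τ =>
    (integral_map measurable_stickProbability.aemeasurable hF.aestronglyMeasurable).trans
      (integral_prod _ (hint τ))
  simp only [heq]
  refine tendsto_integral_filter_of_dominated_convergence (fun _ => ‖F‖)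
    (Eventually.of_forall fun τ => (hint τ).integral_prod_left.aestronglyMeasurable)
    (Eventually.of_forall fun τ => ae_of_all _ fun v => ?_) (integrable_const _) ?_
  · refine (norm_integral_le_of_norm_le_const
      (ae_of_all _ fun x => F.norm_coe_le_norm _)).trans_eq ?_
    simp
  · filter_upwards [ae_tsum_stickWeight_eq_one hβ σ] with v hv
    exact ProbabilityMeasure.tendsto_iff_forall_integral_tendsto.1
      (continuous_infinitePower.tendsto σ)
      (F.compContinuous ⟨_, continuous_stickProbability hv⟩)

/-- Testing `f` against the barycenter of `μ` is testing `η ↦ ∫ f dη` against `μ`, and that function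
is itself bounded and narrowly continuous. -/
theorem continuous_barycenter :
    Continuous (barycenter : ProbabilityMeasure (ProbabilityMeasure X) → _) := by
  refine continuous_iff_continuousAt.2 fun μ => ?_
  refine ProbabilityMeasure.tendsto_iff_forall_lintegral_tendsto.2 fun f => ?_
  let C : NNReal := nndist f 0
  have hC : ∀ η : ProbabilityMeasure X, η.toFiniteMeasure.testAgainstNN f ≤ C := fun η => by
    refine (FiniteMeasure.testAgainstNN_mono (g := BoundedContinuousFunction.const X C) _
      fun x => ?_).trans_eq ?_
    · exact BoundedContinuousFunction.NNReal.upper_bound f x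
    · simp [FiniteMeasure.testAgainstNN_const]
  let Φ : BoundedContinuousFunction (ProbabilityMeasure X) NNReal :=
    BoundedContinuousFunction.mkOfBound
      ⟨_, ProbabilityMeasure.continuous_testAgainstNN_eval f⟩ C fun η ν =>
        abs_sub_le_of_nonneg_of_le (NNReal.coe_nonneg _) (NNReal.coe_le_coe.2 (hC η))
          (NNReal.coe_nonneg _) (NNReal.coe_le_coe.2 (hC ν))
  have heq : ∀ ν : ProbabilityMeasure (ProbabilityMeasure X),
      ∫⁻ a, f a ∂(barycenter ν : Measure X)
        = ∫⁻ η, Φ η ∂(ν : Measure (ProbabilityMeasure X)) := by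
    intro ν
    refine (Measure.lintegral_bind measurable_coe.aemeasurable
      f.continuous.measurable.coe_nnreal_ennreal.aemeasurable).trans (lintegral_congr fun η => ?_)
    exact (FiniteMeasure.testAgainstNN_coe_eq (μ := η.toFiniteMeasure)).symm
  simp only [heq]
  exact ProbabilityMeasure.tendsto_iff_forall_lintegral_tendsto.1 tendsto_id Φ

end Continuity

end DirichletFerguson

theorem mainTheorem10 {X : Type*} [TopologicalSpace X] [T2Space X] [LocallyCompactSpace X]
    [SecondCountableTopology X] [MeasurableSpace X] [BorelSpace X] (β : ℝ) (hβ : 0 < β) :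
    -- The Dirichlet--Ferguson measure of intensity `βσ` exists and is unique.
    (∀ (σ : ProbabilityMeasure X) (D : ProbabilityMeasure (ProbabilityMeasure X)),
      DirichletFerguson.IsDirichletFerguson β σ D ↔ D = DirichletFerguson.dirichletFerguson β σ) ∧
    -- `σ ↦ D_{βσ}` is a homeomorphism onto its image, with inverse the barycenter map.
    ∃ e : ProbabilityMeasure X ≃ₜ
        Set.range (fun σ : ProbabilityMeasure X => DirichletFerguson.dirichletFerguson β σ),
      (∀ σ, (e σ : ProbabilityMeasure (ProbabilityMeasure X))
        = DirichletFerguson.dirichletFerguson β σ) ∧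
      ∀ μ, e.symm μ
        = DirichletFerguson.barycenter (μ : ProbabilityMeasure (ProbabilityMeasure X)) := by
  open DirichletFerguson in
  have hstick : ∀ σ : ProbabilityMeasure X, IsDirichletFerguson β σ (stickBreaking hβ σ) :=
    fun σ => (hasDirichletMoments_stickBreaking hβ σ).isDirichletFerguson hβ
  have hspec : ∀ σ : ProbabilityMeasure X, IsDirichletFerguson β σ (dirichletFerguson β σ) :=
    fun σ => isDirichletFerguson_dirichletFerguson ⟨_, hstick σ⟩
  have huniq : ∀ (σ : ProbabilityMeasure X) (D E : ProbabilityMeasure (ProbabilityMeasure X)),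
      IsDirichletFerguson β σ D → IsDirichletFerguson β σ E → D = E := fun σ D E hD hE =>
    (hD.hasDirichletMoments hβ).unique (hE.hasDirichletMoments hβ)
  -- Uniqueness identifies the chosen measure with the stick-breaking law, from which it inherits
  -- continuity in `σ`.
  have heq : (fun σ : ProbabilityMeasure X => dirichletFerguson β σ) = stickBreaking hβ :=
    funext fun σ => huniq σ _ _ (hspec σ) (hstick σ)
  have hbar : ∀ σ : ProbabilityMeasure X, barycenter (dirichletFerguson β σ) = σ := fun σ =>
    ((hspec σ).hasDirichletMoments hβ).barycenter_eq hβ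
  refine ⟨fun σ D => ⟨fun h => huniq σ _ _ h (hspec σ), fun h => h ▸ hspec σ⟩, ?_⟩
  have hc : Continuous fun σ : ProbabilityMeasure X => dirichletFerguson β σ :=
    heq ▸ continuous_stickBreaking hβ
  refine ⟨{ toFun := fun σ => ⟨dirichletFerguson β σ, σ, rfl⟩
            invFun := fun μ => barycenter μ.1
            left_inv := hbar
            right_inv := ?_
            continuous_toFun := hc.subtype_mk _
            continuous_invFun := continuous_barycenter.comp continuous_subtype_val },
    fun σ => rfl, fun μ => rfl⟩
  rintro ⟨_, σ, rfl⟩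
  exact Subtype.ext (congrArg (dirichletFerguson β) (hbar σ))
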